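/- **Setting.** Let $n_1,n_2\ge 1$, let $F_i:\mathbb R^{N_1}\to\mathbb R$ ($i\le n_1$) and $G_j:\mathbb R^{N_2}\to\mathbb R^{N_1}$ ($j\le n_2$) be differentiable, let $h:\mathbb R^{N_2}\to\mathbb R\cup\{+\infty\}$ be proper, closed and convex, and put $F=\frac1{n_1}\sum_iF_i$, $G=\frac1{n_2}\sum_jG_j$, $f=F\circ G$, $H=f+h$. Norms are Euclidean (spectral for matrices) and $\nabla G_j$ is the Jacobian matrix. Assume that (a) $f$ is convex; (b) every $\nabla F_i$ is $L_F$-Lipschitz and bounded by $B_F$, and every $\nabla G_j$ is $L_G$-Lipschitz and bounded by $B_G$; (c) $\|\nabla G_j(x)^\top\nabla F_i(G(x))-\nabla G_j(y)^\top\nabla F_i(G(y))\|\le L\|x-y\|$ for all $i,j,x,y$. Let $x^*$ be a minimizer of $H$, let $x_0$ satisfy $H(x_0)-H(x^*)\le D_H$ and $\|x_0-x^*\|^2\le D_x$ with $D_H,D_x>0$, and let $\varepsilon>0$, $\mu_0=D_H/D_x$, $T=\max\{0,\lceil\log_2(D_H/\varepsilon)\rceil\}$. Assume $\mu_0\le L$.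 **SoCK** (with outer mini-batches), applied for $S$ epochs from $x$ to $f+h$ with $h$ $\mu$-strongly convex, uses $m=\lceil\frac12\sqrt{L/\mu}\rceil$, $\tau_1=\tau_2=\frac1{2m}$, $\theta=1+\frac1{12m}$, $\alpha=\frac1{3\tau_1L}$, and, rounded up to positive integers, $A=2160B_G^4L_F^2/\mu^2$, $B=2160B_F^2L_G^2/\mu^2$, $C=1080L^2/\mu^2$. Start with $\tilde x^0=y_0=z_0=x$. For $s=0,\dots,S-1$ compute $G(\tilde x^s)$, $\nabla G(\tilde x^s)$ and $\nabla f(\tilde x^s)$, and for $j=0,\dots,m-1$, with $k=sm+j$: put $x_{k+1}=\tau_1z_k+\tau_2\tilde x^s+(1-\tau_1-\tau_2)y_k$; draw independent uniform samples with replacement, $\mathcal A_k,\mathcal B_k$ from $\{1,\dots,n_2\}$ and $\mathcal C_k$ from $\{1,\dots,n_1\}$, of sizes $A,B,C$; put $$\hat G_k=\tfrac1A\sum_{j'\in\mathcal A_k}\big(G_{j'}(x_{k+1})-G_{j'}(\tilde x^s)\big)+G(\tilde x^s),\qquad \nabla\hat G_k=\tfrac1B\sum_{j'\in\mathcal B_k}\big(\nabla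 G_{j'}(x_{k+1})-\nabla G_{j'}(\tilde x^s)\big)+\nabla G(\tilde x^s),$$ $$\tilde\nabla_{k+1}=\tfrac1C\sum_{i\in\mathcal C_k}\big(\nabla\hat G_k^\top\nabla F_i(\hat G_k)-\nabla G(\tilde x^s)^\top\nabla F_i(G(\tilde x^s))\big)+\nabla f(\tilde x^s),$$ $$z_{k+1}=\arg\min_z\langle\tilde\nabla_{k+1},z\rangle+\tfrac1{2\alpha}\|z-z_k\|^2+h(z),\qquad y_{k+1}=\arg\min_y\langle\tilde\nabla_{k+1},y\rangle+\tfrac{3L}2\|y-x_{k+1}\|^2+h(y).$$ Then put $\tilde x^{s+1}=\big(\sum_{j=0}^{m-1}\theta^j\big)^{-1}\sum_{j=0}^{m-1}\theta^jy_{sm+j+1}$. The output is $\tilde x^S$. **NoCK** runs, for $t=0,\dots,T-1$, SoCK for $S$ epochs from $x_t$ on $H_t=H+\frac{\mu_t}2\|\cdot-x_0\|^2$ (that is, with $h$ replaced by $h+\frac{\mu_t}2\|\cdot-x_0\|^2$ and $\mu=\mu_t=\mu_0/2^t$), with fresh samples, and calls the output $x_{t+1}$. It returns $x_T$. **Theorem.**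 There are universal constants $S\in\mathbb N$ and $K$ such that, in every situation as above, the following hold. 1. Every stage achieves $\mathbb E[H_t(x_{t+1})-\min H_t\mid x_t]\le\frac14\big(H_t(x_t)-\min H_t\big)$. 2. $x_T$ is a stochastic $\varepsilon$-solution: $\mathbb E[H(x_T)-H(x^*)]\le\varepsilon$. 3. If $\varepsilon\le D_H/2$, then the total number of evaluations of $G_j$, $\nabla G_j$, $\nabla F_i$ and of the proximal mapping of $h$ is, for every outcome of the sampling, at most $$K\left((n_1+n_2)\log\frac{D_H}{\varepsilon}+\frac{D_x^{2.5}\sqrt L\,\max\{B_G^4L_F^2,\,B_F^2L_G^2,\,L^2\}}{\varepsilon^{2.5}}\right).$$ -/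

import Mathlib

open scoped ENNReal

noncomputable section

/-- `ℝⁿ` with the Euclidean norm. -/
abbrev Vec (n : ℕ) : Type := EuclideanSpace ℝ (Fin n)

/-! ### Randomized algorithms with a counter of oracle calls -/

/-- A randomized computation with result in `α`, given by the joint law of its result and of the
number of oracle calls that it has made. -/
def Alg (α : Type) : Type := PMF (α × ℕ)

namespace Alg

/-- The joint law of the result and of the number of oracle calls. -/
def run {α : Type} (p : Alg α) : PMF (α × ℕ) := p

/-- Return a value without calling an oracle. -/
def ret {α : Type} (a : α) : Alg α := PMF.pure (a, 0)

/-- Run `p`, then run `q` on its result; the numbers of oracle calls add up. -/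
def andThen {α β : Type} (p : Alg α) (q : α → Alg β) : Alg β :=
  PMF.bind p fun r => PMF.map (fun r' => (r'.1, r.2 + r'.2)) (q r.1)

instance : Monad Alg where
  pure := ret
  bind := andThen

/-- One oracle call, answered by `a`. -/
def call {α : Type} (a : α) : Alg α := PMF.pure (a, 1)

/-- Fresh uniform randomness; no oracle call. -/
def uniform (α : Type) [Fintype α] [Nonempty α] : Alg α :=
  PMF.map (fun a => (a, 0)) (PMF.uniformOfFintype α)

/-- Run `c 0, …, c (n - 1)` one after the other and return the sum of the results. -/
def sum {V : Type} [AddCommMonoid V] : (n : ℕ) → (Fin n → Alg V) → Alg V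
  | 0, _ => pure 0
  | n + 1, c => do
      let s ← sum n fun i => c i.castSucc
      let v ← c (Fin.last n)
      pure (s + v)

/-- The loop `for j = 0, …, n - 1` with body `body j` acting on a state. -/
def loop {σ : Type} (body : ℕ → σ → Alg σ) : ℕ → σ → Alg σ
  | 0, s => pure s
  | n + 1, s => do
      let s' ← loop body n s
      body n s'

/-- The law of the result. -/
def law {α : Type} (p : Alg α) : PMF α := PMF.map Prod.fst p.run

end Alg

/-- The expectation of a nonnegative quantity under a discrete law. -/
def expect {α : Type} (p : PMF α) (φ : α → ℝ≥0∞) : ℝ≥0∞ := ∑' a, p a * φ a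

/-! ### The compositional problem -/

/-- The data of the problem
`min_x H(x) = (1/n₁) ∑ᵢ Fᵢ((1/n₂) ∑ⱼ Gⱼ(x)) + h(x)`, with `h` extended-valued. -/
structure COP (n₁ n₂ N₁ N₂ : ℕ) where
  /-- the outer functions -/
  F : Fin n₁ → Vec N₁ → ℝ
  /-- the inner maps -/
  G : Fin n₂ → Vec N₂ → Vec N₁
  /-- the regularizer -/
  h : Vec N₂ → EReal

namespace COP

variable {n₁ n₂ N₁ N₂ : ℕ}

/-- The average of the inner maps. -/
def Gavg (P : COP n₁ n₂ N₁ N₂) (x : Vec N₂) : Vec N₁ := (n₂ : ℝ)⁻¹ • ∑ j, P.G j x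

/-- The average of the outer functions. -/
def Favg (P : COP n₁ n₂ N₁ N₂) (u : Vec N₁) : ℝ := (n₁ : ℝ)⁻¹ * ∑ i, P.F i u

/-- The composition `f = F ∘ G` of the averages. -/
def f (P : COP n₁ n₂ N₁ N₂) (x : Vec N₂) : ℝ := P.Favg (P.Gavg x)

/-- The objective `H = f + h`. -/
def H (P : COP n₁ n₂ N₁ N₂) (x : Vec N₂) : EReal := (P.f x : EReal) + P.h x

/-- The optimality gap `H(x) - inf H`, in `[0, ∞]`. -/
def gap (P : COP n₁ n₂ N₁ N₂) (x : Vec N₂) : ℝ≥0∞ := (P.H x - ⨅ y, P.H y).toENNReal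

/-- `f` is convex, and `h` is a proper closed convex extended-valued function (convexity is
convexity of the epigraph, closedness is lower semicontinuity). -/
structure IsConvex (P : COP n₁ n₂ N₁ N₂) : Prop where
  convex_f : ConvexOn ℝ Set.univ P.f
  h_ne_bot : ∀ x, P.h x ≠ ⊥
  h_proper : ∃ x, P.h x ≠ ⊤
  h_closed : LowerSemicontinuous P.h
  h_convex : Convex ℝ {p : Vec N₂ × ℝ | P.h p.1 ≤ (p.2 : EReal)}

/-- Every `Fᵢ` is `LF`-smooth with `BF`-bounded gradient, and every `Gⱼ` is `LG`-smooth with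
`BG`-bounded Jacobian (spectral norm). -/
structure IsSmooth (P : COP n₁ n₂ N₁ N₂) (LF BF LG BG : ℝ) : Prop where
  LF_nonneg : 0 ≤ LF
  LG_nonneg : 0 ≤ LG
  diff_F : ∀ i, Differentiable ℝ (P.F i)
  diff_G : ∀ j, Differentiable ℝ (P.G j)
  lip_F : ∀ i u v, ‖gradient (P.F i) u - gradient (P.F i) v‖ ≤ LF * ‖u - v‖
  bdd_F : ∀ i u, ‖gradient (P.F i) u‖ ≤ BF
  lip_G : ∀ j x y, ‖fderiv ℝ (P.G j) x - fderiv ℝ (P.G j) y‖ ≤ LG * ‖x - y‖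
  bdd_G : ∀ j x, ‖fderiv ℝ (P.G j) x‖ ≤ BG

/-- `‖∇Gⱼ(x)ᵀ ∇Fᵢ(G(x)) - ∇Gⱼ(y)ᵀ ∇Fᵢ(G(y))‖ ≤ L ‖x - y‖` for all `i`, `j`, `x`, `y`. -/
def IsCompSmooth (P : COP n₁ n₂ N₁ N₂) (L : ℝ) : Prop :=
  ∀ i j x y,
    ‖(fderiv ℝ (P.G j) x).adjoint (gradient (P.F i) (P.Gavg x))
      - (fderiv ℝ (P.G j) y).adjoint (gradient (P.F i) (P.Gavg y))‖ ≤ L * ‖x - y‖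

/-- A law `p` is that of a stochastic `ε`-solution: `E[H(x̄) - inf H] ≤ ε`. -/
def IsStochasticSolution (P : COP n₁ n₂ N₁ N₂) (p : PMF (Vec N₂)) (ε : ℝ) : Prop :=
  expect p P.gap ≤ ENNReal.ofReal ε

/-- The problem with `h` replaced by `h + (μ/2) ‖· - c‖²`. -/
def regularize (P : COP n₁ n₂ N₁ N₂) (c : Vec N₂) (μ : ℝ) : COP n₁ n₂ N₁ N₂ where
  F := P.F
  G := P.G
  h := fun x => P.h x + ((μ / 2 * ‖x - c‖ ^ 2 : ℝ) : EReal)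

/-! ### The oracles: `Gⱼ(x)`, `∇Gⱼ(x)`, `∇Fᵢ(u)` and the proximal mapping of `h` -/

/-- Evaluate `Gⱼ` at `x`. -/
def callG (P : COP n₁ n₂ N₁ N₂) (j : Fin n₂) (x : Vec N₂) : Alg (Vec N₁) := Alg.call (P.G j x)

/-- Evaluate the Jacobian of `Gⱼ` at `x`. -/
def callJ (P : COP n₁ n₂ N₁ N₂) (j : Fin n₂) (x : Vec N₂) : Alg (Vec N₂ →L[ℝ] Vec N₁) :=
  Alg.call (fderiv ℝ (P.G j) x)

/-- Evaluate the gradient of `Fᵢ` at `u`. -/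
def callF (P : COP n₁ n₂ N₁ N₂) (i : Fin n₁) (u : Vec N₁) : Alg (Vec N₁) :=
  Alg.call (gradient (P.F i) u)

/-- A minimizer of an extended-valued function (arbitrary if there is none). -/
def argmin {N : ℕ} (φ : Vec N → EReal) : Vec N := Classical.epsilon fun z => ∀ w, φ z ≤ φ w

theorem argmin_le {N : ℕ} {φ : Vec N → EReal} (hφ : ∃ z, ∀ w, φ z ≤ φ w) (w : Vec N) :
    φ (argmin φ) ≤ φ w :=
  Classical.epsilon_spec hφ w

/-- One proximal step: `argmin_z ⟨g, z⟩ + (η/2) ‖z - c‖² + h(z)`. -/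
def callProx (P : COP n₁ n₂ N₁ N₂) (η : ℝ) (g c : Vec N₂) : Alg (Vec N₂) :=
  Alg.call (argmin fun z => ((inner ℝ g z + η / 2 * ‖z - c‖ ^ 2 : ℝ) : EReal) + P.h z)

end COP

/-! ### SoCK with outer mini-batches -/

/-- The parameters of SoCK (apart from the number of epochs). -/
structure SoCKParams where
  /-- smoothness parameter -/
  L : ℝ
  /-- number of inner loops -/
  m : ℕ
  /-- linear coupling weights -/
  τ₁ : ℝ
  τ₂ : ℝ
  /-- averaging weight -/
  θ : ℝ
  /-- mirror descent step size -/
  α : ℝ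
  /-- mini-batch sizes for the inner maps, their Jacobians and the outer gradients -/
  A : ℕ
  B : ℕ
  C : ℕ

/-- The parameter setting of SoCK with outer mini-batches for a `μ`-strongly convex `h`. The
mini-batch sizes are rounded up to positive integers. -/
def sockParams (L LF BF LG BG μ : ℝ) : SoCKParams :=
  let m : ℕ := ⌈1 / 2 * √(L / μ)⌉₊
  let τ : ℝ := 1 / (2 * m)
  { L := L
    m := m
    τ₁ := τ
    τ₂ := τ
    θ := 1 + 1 / (12 * m)
    α := 1 / (3 * τ * L)
    A := max 1 ⌈2160 * BG ^ 4 * LF ^ 2 / μ ^ 2⌉₊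
    B := max 1 ⌈2160 * BF ^ 2 * LG ^ 2 / μ ^ 2⌉₊
    C := max 1 ⌈1080 * L ^ 2 / μ ^ 2⌉₊ }

/-- A snapshot point `x̃` with the values `G(x̃)`, `∇G(x̃)` and `∇f(x̃)`. -/
structure Snapshot (N₁ N₂ : ℕ) where
  x : Vec N₂
  G : Vec N₁
  J : Vec N₂ →L[ℝ] Vec N₁
  g : Vec N₂

/-- The state of the inner loop: `y_k`, `z_k`, and the sum of `θ^j y_{sm+j+1}` so far. -/
structure InnerState (N : ℕ) where
  y : Vec N
  z : Vec N
  acc : Vec N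

/-- The state of the outer loop: the snapshot point, `y_{sm}` and `z_{sm}`. -/
structure OuterState (N : ℕ) where
  xt : Vec N
  y : Vec N
  z : Vec N

section SoCK

variable {n₁ n₂ N₁ N₂ : ℕ}

/-- Compute `G(x̃)`, `∇G(x̃)` and `∇f(x̃) = ∇G(x̃)ᵀ ∇F(G(x̃))`. -/
def takeSnapshot (P : COP n₁ n₂ N₁ N₂) (x : Vec N₂) : Alg (Snapshot N₁ N₂) := do
  let sG ← Alg.sum n₂ fun j => P.callG j x
  let Gx : Vec N₁ := (n₂ : ℝ)⁻¹ • sG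
  let sJ ← Alg.sum n₂ fun j => P.callJ j x
  let Jx : Vec N₂ →L[ℝ] Vec N₁ := (n₂ : ℝ)⁻¹ • sJ
  let sF ← Alg.sum n₁ fun i => P.callF i Gx
  pure { x := x, G := Gx, J := Jx, g := Jx.adjoint ((n₁ : ℝ)⁻¹ • sF) }

/-- One inner iteration: linear coupling, gradient estimation from mini-batches drawn with
replacement, mirror descent step, gradient descent step. -/
def innerStep [NeZero n₁] [NeZero n₂] (P : COP n₁ n₂ N₁ N₂) (p : SoCKParams)
    (snap : Snapshot N₁ N₂) (j : ℕ) (s : InnerState N₂) : Alg (InnerState N₂) := do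
  let x : Vec N₂ := p.τ₁ • s.z + p.τ₂ • snap.x + (1 - p.τ₁ - p.τ₂) • s.y
  let a ← Alg.uniform (Fin p.A → Fin n₂)
  let b ← Alg.uniform (Fin p.B → Fin n₂)
  let dG ← Alg.sum p.A fun k => do
    let u ← P.callG (a k) x
    let v ← P.callG (a k) snap.x
    pure (u - v)
  let Ghat : Vec N₁ := (p.A : ℝ)⁻¹ • dG + snap.G
  let dJ ← Alg.sum p.B fun k => do
    let u ← P.callJ (b k) x
    let v ← P.callJ (b k) snap.x
    pure (u - v)
  let Jhat : Vec N₂ →L[ℝ] Vec N₁ := (p.B : ℝ)⁻¹ • dJ + snap.J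
  let c ← Alg.uniform (Fin p.C → Fin n₁)
  let d ← Alg.sum p.C fun k => do
    let u ← P.callF (c k) Ghat
    let v ← P.callF (c k) snap.G
    pure (Jhat.adjoint u - snap.J.adjoint v)
  let g : Vec N₂ := (p.C : ℝ)⁻¹ • d + snap.g
  let z' ← P.callProx (1 / p.α) g s.z
  let y' ← P.callProx (3 * p.L) g x
  pure { y := y', z := z', acc := s.acc + p.θ ^ j • y' }

/-- One epoch: take a snapshot, run the inner loop, update the snapshot point. -/
def epoch [NeZero n₁] [NeZero n₂] (P : COP n₁ n₂ N₁ N₂) (p : SoCKParams)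
    (s : OuterState N₂) : Alg (OuterState N₂) := do
  let snap ← takeSnapshot P s.xt
  let r ← Alg.loop (innerStep P p snap) p.m { y := s.y, z := s.z, acc := 0 }
  pure { xt := (∑ j ∈ Finset.range p.m, p.θ ^ j)⁻¹ • r.acc, y := r.y, z := r.z }

/-- SoCK with outer mini-batches, run for `S` epochs from `x`. -/
def sock [NeZero n₁] [NeZero n₂] (P : COP n₁ n₂ N₁ N₂) (p : SoCKParams) (S : ℕ)
    (x : Vec N₂) : Alg (Vec N₂) := do
  let r ← Alg.loop (fun _ => epoch P p) S { xt := x, y := x, z := x }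
  pure r.xt

/-- NoCK from `x₀` with initial strong convexity constant `μ₀`: the stage `t` applies SoCK, from
the current point, to `H + (μ_t/2) ‖· - x₀‖²` with `μ_t = μ₀ / 2^t`. -/
def nock [NeZero n₁] [NeZero n₂] (P : COP n₁ n₂ N₁ N₂) (L LF BF LG BG : ℝ) (S : ℕ) (μ₀ : ℝ)
    (T : ℕ) (x₀ : Vec N₂) : Alg (Vec N₂) :=
  Alg.loop
    (fun t x => sock (P.regularize x₀ (μ₀ / 2 ^ t)) (sockParams L LF BF LG BG (μ₀ / 2 ^ t)) S x)
    T x₀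

end SoCK

end

open scoped BigOperators

/-! ### Expectations and costs of randomized computations -/

/-! Everything rests on a linear contraction of SoCK on a composite problem with `μ`-strongly convex
`h` and minimizer `u`; NoCK then follows by halving `μ` and summing a geometric series of costs.

The gradient estimator is biased, because the outer gradients are evaluated at a sampled inner
value. Only its mean square error is used. That error splits into a Jacobian part, an inner-value
part and an outer-sampling part, each inversely proportional to one batch size, and the batch sizes
make it at most `μ² / 180 * ‖x - xt‖²` (`COP.expect_norm_estGrad_sub_sq_le`). The displacement `x -
xt` is controlled by the distances of `z`, `y`, `xt` from `u`. For `y` and `xt`, strong convexity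
turns these into optimality gaps; for `z`, the distance is already part of the potential
(`absorb_error`).

The deterministic inequality `coupling_step_le` adds the gradient step, the mirror step and the
convexity of `f`. Bounding its error terms by Young's inequality leaves an expected one-step
inequality (`expect_step_le`) in the gaps at `y` and `xt` and the squared distance of `z`.
Multiplying the step `j` by `θ ^ j` makes it telescope, and convexity of the gap passes to the
weighted average that becomes the next snapshot. One epoch contracts the potential by `12 / 13`
(`expect_outerPot_le`), and 100 epochs divide the gap by at least 16 (`expect_sock_gap_le`).

For NoCK, passing from `μ_t` to `μ_t / 2` raises the gap by at most `μ_t * Dx / 4`, so by induction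
the gap of the stage `t` is at most `DH / 2 ^ t` in expectation. A midpoint argument transfers the
last bound to `H`. The sampling cost of a stage is of order `√L * max * μ_t ^ (-5/2)`, which grows
geometrically, so the last stage dominates.

Gaps live in `[0, ∞]` and equal `⊤` off the domain of `h`. The inequalities therefore hold at every
state, and no invariant about reachable states is needed. -/

theorem expect_pure {α : Type} (a : α) (φ : α → ℝ≥0∞) : expect (PMF.pure a) φ = φ a := by
  classical
  unfold expect
  rw [tsum_eq_single a]
  · simp
  · intro b hb
    simp [PMF.pure_apply, hb]

theorem expect_bind {α β : Type} (p : PMF α) (q : α → PMF β) (φ : β → ℝ≥0∞) :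
    expect (p.bind q) φ = expect p fun a => expect (q a) φ := by
  unfold expect
  simp only [PMF.bind_apply, ← ENNReal.tsum_mul_right, ← ENNReal.tsum_mul_left]
  rw [ENNReal.tsum_comm]
  simp only [mul_assoc]

theorem expect_mono {α : Type} (p : PMF α) {φ ψ : α → ℝ≥0∞} (h : ∀ a, φ a ≤ ψ a) :
    expect p φ ≤ expect p ψ :=
  ENNReal.tsum_le_tsum fun a => mul_le_mul_right (h a) _

theorem expect_add {α : Type} (p : PMF α) (φ ψ : α → ℝ≥0∞) :
    expect p (fun a => φ a + ψ a) = expect p φ + expect p ψ := by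
  simp only [expect, mul_add, ENNReal.tsum_add]

theorem expect_const {α : Type} (p : PMF α) (c : ℝ≥0∞) : expect p (fun _ => c) = c := by
  simp only [expect, ENNReal.tsum_mul_right, p.tsum_coe, one_mul]

theorem expect_const_mul {α : Type} (p : PMF α) (c : ℝ≥0∞) (φ : α → ℝ≥0∞) :
    expect p (fun a => c * φ a) = c * expect p φ := by
  simp only [expect, ← ENNReal.tsum_mul_left]
  exact tsum_congr fun a => by ring

/-- The bridge to finite real averages, where signed cross terms can cancel; everything outside one
inner iteration stays in `ℝ≥0∞`. -/
theorem expect_uniformOfFintype {α : Type} [Fintype α] [Nonempty α] (ψ : α → ℝ)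
    (h : ∀ a, 0 ≤ ψ a) :
    expect (PMF.uniformOfFintype α) (fun a => ENNReal.ofReal (ψ a))
      = ENNReal.ofReal (𝔼 a, ψ a) := by
  have hc : (0 : ℝ) < Fintype.card α := by exact_mod_cast Fintype.card_pos
  simp only [expect, PMF.uniformOfFintype_apply]
  rw [tsum_fintype, ← Finset.mul_sum, ← ENNReal.ofReal_sum_of_nonneg fun a _ => h a,
    Fintype.expect_eq_sum_div_card, div_eq_inv_mul, ENNReal.ofReal_mul (by positivity),
    ENNReal.ofReal_inv_of_pos hc, ENNReal.ofReal_natCast]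

namespace Alg

/-- The deterministic computation with result `a` and `n` oracle calls. -/
noncomputable def charged {α : Type} (a : α) (n : ℕ) : Alg α := PMF.pure (a, n)

theorem pure_eq {α : Type} (a : α) : (pure a : Alg α) = charged a 0 := rfl

theorem call_eq {α : Type} (a : α) : call a = charged a 1 := rfl

theorem bind_eq {α β : Type} (p : Alg α) (q : α → Alg β) :
    p >>= q = PMF.bind p fun r => PMF.map (fun r' => (r'.1, r.2 + r'.2)) (q r.1) := rfl

theorem charged_bind_charged {α β : Type} (a : α) (n : ℕ) (f : α → β) (k : ℕ) :
    (charged a n >>= fun u => charged (f u) k) = charged (f a) (n + k) := by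
  rw [bind_eq]
  unfold charged
  rw [PMF.pure_bind, PMF.pure_map]

theorem sum_charged {V : Type} [AddCommMonoid V] (n : ℕ) (v : Fin n → V) (k : ℕ) :
    (Alg.sum n fun i => charged (v i) k) = charged (∑ i, v i) (n * k) := by
  induction n with
  | zero => simp [Alg.sum, pure_eq]
  | succ n ih =>
    rw [Alg.sum, ih, Fin.sum_univ_castSucc]
    simp only [pure_eq, charged_bind_charged]
    congr 1
    ring

theorem law_bind {α β : Type} (p : Alg α) (q : α → Alg β) :
    (p >>= q).law = p.law.bind fun a => (q a).law := by
  refine (PMF.map_bind (α := α × ℕ) p _ _).trans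
    (Eq.trans ?_ (PMF.bind_map (α := α × ℕ) p _ _).symm)
  exact congrArg (PMF.bind (α := α × ℕ) p) (funext fun r => PMF.map_comp (α := β × ℕ) _ _ _)

theorem law_charged {α : Type} (a : α) (n : ℕ) : (charged a n).law = PMF.pure a := by
  simp [law, run, charged, PMF.pure_map]

theorem law_uniform (α : Type) [Fintype α] [Nonempty α] :
    (uniform α).law = PMF.uniformOfFintype α := by
  simp [law, run, uniform, PMF.map_comp, Function.comp_def]
  exact PMF.map_id _

theorem expect_law_bind {α β : Type} (p : Alg α) (q : α → Alg β) (φ : β → ℝ≥0∞) :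
    expect (p >>= q).law φ = expect p.law fun a => expect (q a).law φ := by
  rw [law_bind, expect_bind]

theorem expect_law_charged {α : Type} (a : α) (n : ℕ) (φ : α → ℝ≥0∞) :
    expect (charged a n).law φ = φ a := by
  rw [law_charged, expect_pure]

/-- A supermartingale argument with additive drift. The hypothesis ranges over all states, which is
why the potentials must make sense off the domain. -/
theorem expect_law_loop_le {σ : Type} (body : ℕ → σ → Alg σ) (V : ℕ → σ → ℝ≥0∞) (c : ℕ → ℝ≥0∞)
    (h : ∀ j s, expect (body j s).law (V (j + 1)) ≤ V j s + c j) (n : ℕ) (s : σ) :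
    expect (loop body n s).law (V n) ≤ V 0 s + ∑ j ∈ Finset.range n, c j := by
  induction n with
  | zero => simp [loop, pure_eq, expect_law_charged]
  | succ n ih =>
    rw [loop, expect_law_bind]
    calc _ ≤ expect (loop body n s).law (fun s => V n s + c n) := expect_mono _ fun s => h n s
      _ = expect (loop body n s).law (V n) + c n := by rw [expect_add, expect_const]
      _ ≤ _ := by rw [Finset.sum_range_succ, ← add_assoc]; gcongr

/-- Every outcome of `p` makes at most `n` oracle calls. -/
def CostLe {α : Type} (p : Alg α) (n : ℕ) : Prop := ∀ r ∈ p.run.support, r.2 ≤ n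

theorem CostLe.mono {α : Type} {p : Alg α} {m n : ℕ} (h : p.CostLe m) (hmn : m ≤ n) :
    p.CostLe n := fun r hr => (h r hr).trans hmn

theorem costLe_charged {α : Type} (a : α) (n : ℕ) : (charged a n).CostLe n := by
  intro r hr
  simp only [run, charged, PMF.support_pure, Set.mem_singleton_iff] at hr
  simp [hr]

theorem costLe_uniform (α : Type) [Fintype α] [Nonempty α] : (uniform α).CostLe 0 := by
  intro r hr
  simp only [run, uniform, PMF.support_map] at hr
  obtain ⟨a, -, rfl⟩ := hr
  simp

theorem CostLe.bind {α β : Type} {p : Alg α} {q : α → Alg β} {m n : ℕ} (hp : p.CostLe m)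
    (hq : ∀ a, (q a).CostLe n) : (p >>= q).CostLe (m + n) := by
  intro r hr
  obtain ⟨r₁, h₁, h⟩ := (PMF.mem_support_bind_iff (α := α × ℕ) p _ r).1 hr
  obtain ⟨r₂, h₂, rfl⟩ := (PMF.mem_support_map_iff (α := β × ℕ) _ _ _).1 h
  exact Nat.add_le_add (hp r₁ h₁) (hq _ r₂ h₂)

theorem CostLe.loop {σ : Type} {body : ℕ → σ → Alg σ} {c : ℕ → ℕ}
    (h : ∀ j s, (body j s).CostLe (c j)) (n : ℕ) (s : σ) :
    (Alg.loop body n s).CostLe (∑ j ∈ Finset.range n, c j) := by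
  induction n with
  | zero => simpa [Alg.loop, pure_eq] using costLe_charged s 0
  | succ n ih =>
    rw [Alg.loop, Finset.sum_range_succ]
    exact ih.bind fun s => h n s

end Alg

/-! ### Smooth and strongly convex functions -/

section Smooth

variable {E : Type*} [NormedAddCommGroup E] [InnerProductSpace ℝ E] [CompleteSpace E]

theorem HasGradientAt.hasDerivAt_line {f : E → ℝ} {g x d : E} {t : ℝ}
    (hf : HasGradientAt f g (x + t • d)) :
    HasDerivAt (fun s : ℝ => f (x + s • d)) (inner ℝ g d) t := by
  have h1 : HasDerivAt (fun s : ℝ => x + s • d) d t := by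
    simpa using ((hasDerivAt_id t).smul_const d).const_add x
  simpa using! hf.hasFDerivAt.comp_hasDerivAt t h1

theorem le_quadratic_of_lipschitz_gradient {f : E → ℝ} {g : E → E} {L : ℝ}
    (hf : ∀ x, HasGradientAt f (g x) x) (hg : ∀ x y, ‖g x - g y‖ ≤ L * ‖x - y‖) (x y : E) :
    f y ≤ f x + inner ℝ (g x) (y - x) + L / 2 * ‖y - x‖ ^ 2 := by
  set d := y - x with hd
  let φ : ℝ → ℝ := fun t => f (x + t • d) - (t * inner ℝ (g x) d + L / 2 * ‖d‖ ^ 2 * t ^ 2)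
  have hφ : ∀ t, HasDerivAt φ
      (inner ℝ (g (x + t • d)) d - (inner ℝ (g x) d + L / 2 * ‖d‖ ^ 2 * (2 * t))) t := by
    intro t
    have h2 := ((hasDerivAt_id t).mul_const (inner ℝ (g x) d)).add
      (((hasDerivAt_pow 2 t)).const_mul (L / 2 * ‖d‖ ^ 2))
    have h3 := (hf (x + t • d)).hasDerivAt_line.sub h2
    exact h3.congr_deriv (by norm_num)
  have hanti : AntitoneOn φ (Set.Icc 0 1) := by
    refine antitoneOn_of_deriv_nonpos (convex_Icc 0 1)
      (fun t _ => (hφ t).continuousAt.continuousWithinAt)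
      (fun t _ => (hφ t).differentiableAt.differentiableWithinAt) fun t ht => ?_
    rw [interior_Icc] at ht
    rw [(hφ t).deriv]
    have h4 : inner ℝ (g (x + t • d) - g x) d ≤ L * (t * ‖d‖) * ‖d‖ := by
      refine (real_inner_le_norm _ _).trans ?_
      gcongr
      refine (hg _ _).trans (le_of_eq ?_)
      rw [add_sub_cancel_left, norm_smul, Real.norm_of_nonneg ht.1.le]
    rw [inner_sub_left] at h4
    nlinarith
  have h := hanti (Set.left_mem_Icc.2 zero_le_one) (Set.right_mem_Icc.2 zero_le_one) zero_le_one
  simp only [φ, zero_smul, one_smul, add_zero, hd, add_sub_cancel] at h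
  rw [hd]
  linarith

theorem ConvexOn.add_inner_gradient_le {f : E → ℝ} {g x : E} (hc : ConvexOn ℝ Set.univ f)
    (hf : HasGradientAt f g x) (y : E) : f x + inner ℝ g (y - x) ≤ f y := by
  have hcl : ConvexOn ℝ Set.univ (fun t : ℝ => f (x + t • (y - x))) := by
    have := hc.comp_affineMap (AffineMap.lineMap x y : ℝ →ᵃ[ℝ] E)
    simpa [Function.comp_def, AffineMap.lineMap_apply, add_comm] using this
  have hd : HasDerivAt (fun t : ℝ => f (x + t • (y - x))) (inner ℝ g (y - x)) 0 :=
    HasGradientAt.hasDerivAt_line (by simpa using hf)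
  have h := hcl.le_slope_of_hasDerivAt (Set.mem_univ 0) (Set.mem_univ 1) zero_lt_one hd
  simp [slope_def_field] at h
  linarith

end Smooth

section StrongConvex

variable {E : Type*} [NormedAddCommGroup E] [InnerProductSpace ℝ E]

theorem StrongConvexOn.add_inner_add_sq {s : Set E} {m : ℝ} {φ : E → ℝ}
    (h : StrongConvexOn s m φ) (g c : E) (η : ℝ) :
    StrongConvexOn s (m + η) fun z => inner ℝ g z + η / 2 * ‖z - c‖ ^ 2 + φ z := by
  rw [strongConvexOn_iff_convex] at h ⊢
  have h1 : ConvexOn ℝ s fun z => inner ℝ (g - η • c) z :=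
    (innerSL ℝ (g - η • c)).toLinearMap.convexOn h.1
  refine ((h.add h1).add_const (η / 2 * ‖c‖ ^ 2)).congr fun z _ => ?_
  simp only [Pi.add_apply]
  rw [norm_sub_sq_real, inner_sub_left, real_inner_smul_left, real_inner_comm z c]
  ring

/-- Compare `z` with points on the segment towards `w`, divide by the step length `t` and let `t →
0`. -/
theorem StrongConvexOn.le_sub_of_isMinOn {s : Set E} {m : ℝ} {φ : E → ℝ}
    (h : StrongConvexOn s m φ) {z w : E} (hz : z ∈ s) (hw : w ∈ s) (hmin : ∀ v ∈ s, φ z ≤ φ v) :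
    φ z + m / 2 * ‖w - z‖ ^ 2 ≤ φ w := by
  have key : ∀ t ∈ Set.Ioo (0 : ℝ) 1, φ z + (1 - t) * (m / 2 * ‖w - z‖ ^ 2) ≤ φ w := by
    intro t ht
    have h1 := h.2 hw hz ht.1.le (sub_nonneg.2 ht.2.le) (add_sub_cancel t 1)
    have h2 := hmin _ (h.1 hw hz ht.1.le (sub_nonneg.2 ht.2.le) (add_sub_cancel t 1))
    simp only [smul_eq_mul] at h1
    have h3 : 0 ≤ t * (φ w - φ z - (1 - t) * (m / 2 * ‖w - z‖ ^ 2)) := by linarith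
    have := nonneg_of_mul_nonneg_right h3 ht.1
    linarith
  have hlim : Filter.Tendsto (fun t : ℝ => φ z + (1 - t) * (m / 2 * ‖w - z‖ ^ 2))
      (nhdsWithin 0 (Set.Ioi 0)) (nhds (φ z + m / 2 * ‖w - z‖ ^ 2)) := by
    have : Continuous fun t : ℝ => φ z + (1 - t) * (m / 2 * ‖w - z‖ ^ 2) := by fun_prop
    have h0 := this.tendsto 0
    simp only [sub_zero, one_mul] at h0
    exact h0.mono_left nhdsWithin_le_nhds
  exact le_of_tendsto hlim
    (Filter.mem_of_superset (Ioo_mem_nhdsGT zero_lt_one) key)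

end StrongConvex

theorem exists_forall_le_of_quadratic_le {E : Type*} [NormedAddCommGroup E]
    [NormedSpace ℝ E] [FiniteDimensional ℝ E] {φ : E → EReal} (hφ : LowerSemicontinuous φ)
    {x₀ p : E} (hx₀ : φ x₀ ≠ ⊤) {a b : ℝ} (ha : 0 < a)
    (hb : ∀ x, ((a * ‖x - p‖ ^ 2 - b : ℝ) : EReal) ≤ φ x) : ∃ z, ∀ w, φ z ≤ φ w := by
  have : ProperSpace E := FiniteDimensional.proper ℝ E
  obtain ⟨r, hr⟩ : ∃ r : ℝ, φ x₀ = r := by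
    refine ⟨(φ x₀).toReal, (EReal.coe_toReal hx₀ fun h => ?_).symm⟩
    have := hb x₀
    rw [h] at this
    exact absurd (le_bot_iff.1 this) (EReal.coe_ne_bot _)
  set R := √((r + b) / a) with hR
  have hmem : ∀ x, φ x ≤ r → x ∈ Metric.closedBall p R := by
    intro x hx
    have h1 : a * ‖x - p‖ ^ 2 - b ≤ r := by exact_mod_cast (hb x).trans hx
    rw [mem_closedBall_iff_norm]
    refine Real.le_sqrt_of_sq_le ?_
    rw [le_div_iff₀ ha]
    linarith
  obtain ⟨z, -, hz⟩ := (hφ.lowerSemicontinuousOn _).exists_isMinOn ⟨x₀, hmem x₀ hr.le⟩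
    (isCompact_closedBall p R)
  refine ⟨z, fun w => ?_⟩
  by_cases hw : φ w ≤ r
  · exact hz (hmem w hw)
  · have h0 : φ z ≤ φ x₀ := hz (hmem x₀ hr.le)
    exact h0.trans (hr.le.trans (not_le.1 hw).le)

/-! ### Averages and sampling with replacement -/

section Sampling

variable {E : Type*} [NormedAddCommGroup E] [InnerProductSpace ℝ E]

theorem norm_inv_smul_sum_le {E : Type*} [NormedAddCommGroup E] [NormedSpace ℝ E] {n : ℕ}
    [NeZero n] (v : Fin n → E) {K : ℝ} (h : ∀ i, ‖v i‖ ≤ K) :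
    ‖(n : ℝ)⁻¹ • ∑ i, v i‖ ≤ K := by
  have hn : (0 : ℝ) < n := by exact_mod_cast Nat.pos_of_neZero n
  rw [norm_smul, Real.norm_of_nonneg (by positivity), inv_mul_le_iff₀ hn]
  calc ‖∑ i, v i‖ ≤ ∑ i, ‖v i‖ := norm_sum_le _ _
    _ ≤ ∑ _i : Fin n, K := Finset.sum_le_sum fun i _ => h i
    _ = n * K := by simp

theorem norm_inv_smul_sum_sq_le {n : ℕ} [NeZero n] (v : Fin n → E) :
    ‖(n : ℝ)⁻¹ • ∑ i, v i‖ ^ 2 ≤ 𝔼 i, ‖v i‖ ^ 2 := by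
  have hn : (0 : ℝ) < n := by exact_mod_cast Nat.pos_of_neZero n
  rw [norm_smul, Real.norm_of_nonneg (by positivity), Fintype.expect_eq_sum_div_card,
    Fintype.card_fin, mul_pow, le_div_iff₀ hn]
  have h1 : ‖∑ i, v i‖ ^ 2 ≤ n * ∑ i, ‖v i‖ ^ 2 := by
    calc ‖∑ i, v i‖ ^ 2 ≤ (∑ i, ‖v i‖) ^ 2 := by gcongr; exact norm_sum_le _ _
      _ ≤ _ := by simpa using sq_sum_le_card_mul_sum_sq (s := Finset.univ) (f := fun i => ‖v i‖)
  calc (n : ℝ)⁻¹ ^ 2 * ‖∑ i, v i‖ ^ 2 * n ≤ (n : ℝ)⁻¹ ^ 2 * (n * ∑ i, ‖v i‖ ^ 2) * n := by gcongr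
    _ = _ := by field_simp

/-- Independent centred samples are orthogonal in mean. The induction splits off the first sample,
and its cross term averages to zero. -/
theorem expect_norm_sum_sq_of_sum_eq_zero {N : ℕ} [NeZero N] (X : Fin N → E) (h : ∑ i, X i = 0)
    (n : ℕ) : 𝔼 a : Fin n → Fin N, ‖∑ k, X (a k)‖ ^ 2 = n * 𝔼 i, ‖X i‖ ^ 2 := by
  induction n with
  | zero => simp
  | succ n ih =>
    rw [← Fintype.expect_equiv (Fin.consEquiv fun _ : Fin (n + 1) => Fin N)
      (fun p => ‖X p.1 + ∑ k, X (p.2 k)‖ ^ 2) _ fun p => by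
        simp [Fin.sum_univ_succ, Fin.consEquiv]]
    rw [← Finset.univ_product_univ, Finset.expect_product, Finset.expect_comm]
    have h1 : ∀ a : Fin n → Fin N, 𝔼 i, ‖X i + ∑ k, X (a k)‖ ^ 2
        = 𝔼 i, ‖X i‖ ^ 2 + ‖∑ k, X (a k)‖ ^ 2 := by
      intro a
      have h2 : 𝔼 i, 2 * inner ℝ (X i) (∑ k, X (a k)) = 0 := by
        rw [← Finset.mul_expect, Fintype.expect_eq_sum_div_card, ← sum_inner, h]
        simp
      simp only [norm_add_sq_real, Finset.expect_add_distrib, h2, Fintype.expect_const, add_zero]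
    simp only [h1, Finset.expect_add_distrib, ih, Fintype.expect_const]
    push_cast
    ring

theorem expect_norm_sub_mean_sq_le {N : ℕ} [NeZero N] (Y : Fin N → E) :
    𝔼 i, ‖Y i - (N : ℝ)⁻¹ • ∑ j, Y j‖ ^ 2 ≤ 𝔼 i, ‖Y i‖ ^ 2 := by
  have hn : (N : ℝ) ≠ 0 := by exact_mod_cast NeZero.ne N
  set M := (N : ℝ)⁻¹ • ∑ j, Y j with hM
  have h2 : 𝔼 i, 2 * inner ℝ (Y i) M = 2 * ‖M‖ ^ 2 := by
    rw [← Finset.mul_expect, Fintype.expect_eq_sum_div_card, ← sum_inner, Fintype.card_fin,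
      div_eq_inv_mul, ← real_inner_smul_left, ← hM, real_inner_self_eq_norm_sq]
  simp only [norm_sub_sq_real, Finset.expect_add_distrib, Finset.expect_sub_distrib, h2,
    Fintype.expect_const]
  nlinarith [sq_nonneg ‖M‖]

theorem expect_norm_sample_mean_sub_mean_sq_le {N n : ℕ} [NeZero N] (hn : 0 < n) (Y : Fin N → E)
    {K : ℝ} (hK : ∀ i, ‖Y i‖ ≤ K) :
    𝔼 a : Fin n → Fin N, ‖(n : ℝ)⁻¹ • ∑ k, Y (a k) - (N : ℝ)⁻¹ • ∑ i, Y i‖ ^ 2 ≤ K ^ 2 / n := by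
  have hn' : (0 : ℝ) < n := by exact_mod_cast hn
  have hN : (N : ℝ) ≠ 0 := by exact_mod_cast NeZero.ne N
  set M := (N : ℝ)⁻¹ • ∑ j, Y j with hM
  have h0 : ∑ i, (Y i - M) = 0 := by
    rw [Finset.sum_sub_distrib, Finset.sum_const, Finset.card_univ, Fintype.card_fin,
      ← Nat.cast_smul_eq_nsmul ℝ, hM, smul_inv_smul₀ hN, sub_self]
  have h1 : ∀ a : Fin n → Fin N, ‖(n : ℝ)⁻¹ • ∑ k, Y (a k) - M‖ ^ 2
      = (n : ℝ)⁻¹ ^ 2 * ‖∑ k, (Y (a k) - M)‖ ^ 2 := by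
    intro a
    rw [← mul_pow, ← Real.norm_of_nonneg (inv_nonneg.2 hn'.le), ← norm_smul,
      Real.norm_of_nonneg (inv_nonneg.2 hn'.le), Finset.sum_sub_distrib, Finset.sum_const,
      Finset.card_univ, Fintype.card_fin, ← Nat.cast_smul_eq_nsmul ℝ, smul_sub,
      inv_smul_smul₀ hn'.ne']
  simp only [h1, ← Finset.mul_expect]
  rw [expect_norm_sum_sq_of_sum_eq_zero _ h0]
  have h2 : 𝔼 i, ‖Y i‖ ^ 2 ≤ K ^ 2 :=
    Finset.expect_le Finset.univ_nonempty fun i _ => by gcongr; exact hK i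
  have h3 := (expect_norm_sub_mean_sq_le Y).trans h2
  rw [← hM] at h3
  calc _ = (𝔼 i, ‖Y i - M‖ ^ 2) / n := by field_simp
    _ ≤ _ := by gcongr

end Sampling

/-! ### The gradient estimator -/

namespace COP

variable {n₁ n₂ N₁ N₂ : ℕ} (P : COP n₁ n₂ N₁ N₂)

/-- The average of the Jacobians of the inner maps. -/
noncomputable def jac (x : Vec N₂) : Vec N₂ →L[ℝ] Vec N₁ := (n₂ : ℝ)⁻¹ • ∑ j, fderiv ℝ (P.G j) x

/-- The average of the gradients of the outer functions. -/
noncomputable def gradF (u : Vec N₁) : Vec N₁ := (n₁ : ℝ)⁻¹ • ∑ i, gradient (P.F i) u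

/-- The gradient of the composition `f`. -/
noncomputable def gradf (x : Vec N₂) : Vec N₂ := (P.jac x).adjoint (P.gradF (P.Gavg x))

variable {P} {L LF BF LG BG : ℝ}

theorem IsSmooth.hasGradientAt_f (hs : P.IsSmooth LF BF LG BG) (x : Vec N₂) :
    HasGradientAt P.f (P.gradf x) x := by
  have hG : HasFDerivAt P.Gavg (P.jac x) x :=
    (HasFDerivAt.fun_sum fun j _ => (hs.diff_G j x).hasFDerivAt).const_smul (n₂ : ℝ)⁻¹
  have hF : HasFDerivAt P.Favg ((n₁ : ℝ)⁻¹ • ∑ i, fderiv ℝ (P.F i) (P.Gavg x)) (P.Gavg x) :=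
    (HasFDerivAt.fun_sum fun i _ => (hs.diff_F i (P.Gavg x)).hasFDerivAt).const_mul (n₁ : ℝ)⁻¹
  rw [hasGradientAt_iff_hasFDerivAt]
  refine HasFDerivAt.congr_fderiv (f := P.f) (hF.comp x hG) ?_
  ext v
  simp [gradf, gradF, ContinuousLinearMap.adjoint_inner_left]

theorem IsSmooth.BG_nonneg [NeZero n₂] (hs : P.IsSmooth LF BF LG BG) : 0 ≤ BG :=
  (norm_nonneg _).trans (hs.bdd_G 0 0)

theorem IsSmooth.norm_G_sub_le (hs : P.IsSmooth LF BF LG BG) (j : Fin n₂) (x y : Vec N₂) :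
    ‖P.G j x - P.G j y‖ ≤ BG * ‖x - y‖ :=
  convex_univ.norm_image_sub_le_of_norm_fderiv_le (fun z _ => hs.diff_G j z)
    (fun z _ => hs.bdd_G j z) (Set.mem_univ y) (Set.mem_univ x)

theorem adjoint_jac_apply (x : Vec N₂) (w : Vec N₁) :
    (P.jac x).adjoint w = (n₂ : ℝ)⁻¹ • ∑ j, (fderiv ℝ (P.G j) x).adjoint w := by
  simp [jac, map_sum]

theorem gradf_eq (x : Vec N₂) :
    P.gradf x = (n₁ : ℝ)⁻¹ • ∑ i, (P.jac x).adjoint (gradient (P.F i) (P.Gavg x)) := by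
  simp [gradf, gradF, map_sum]

theorem IsCompSmooth.norm_jac_sub_le [NeZero n₂] (hc : P.IsCompSmooth L) (i : Fin n₁)
    (x y : Vec N₂) :
    ‖(P.jac x).adjoint (gradient (P.F i) (P.Gavg x))
      - (P.jac y).adjoint (gradient (P.F i) (P.Gavg y))‖ ≤ L * ‖x - y‖ := by
  rw [adjoint_jac_apply, adjoint_jac_apply, ← smul_sub, ← Finset.sum_sub_distrib]
  exact norm_inv_smul_sum_le _ fun j => hc i j x y

theorem IsCompSmooth.norm_gradf_sub_le [NeZero n₁] [NeZero n₂] (hc : P.IsCompSmooth L)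
    (x y : Vec N₂) : ‖P.gradf x - P.gradf y‖ ≤ L * ‖x - y‖ := by
  rw [gradf_eq, gradf_eq, ← smul_sub, ← Finset.sum_sub_distrib]
  exact norm_inv_smul_sum_le _ fun i => hc.norm_jac_sub_le i x y

variable (P)

/-- The mini-batch estimate of the inner value. -/
noncomputable def estG {A : ℕ} (x xt : Vec N₂) (a : Fin A → Fin n₂) : Vec N₁ :=
  (A : ℝ)⁻¹ • ∑ k, (P.G (a k) x - P.G (a k) xt) + P.Gavg xt

/-- The mini-batch estimate of the inner Jacobian. -/
noncomputable def estJ {B : ℕ} (x xt : Vec N₂) (b : Fin B → Fin n₂) : Vec N₂ →L[ℝ] Vec N₁ :=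
  (B : ℝ)⁻¹ • ∑ k, (fderiv ℝ (P.G (b k)) x - fderiv ℝ (P.G (b k)) xt) + P.jac xt

/-- The mini-batch estimate of the gradient of `f`. -/
noncomputable def estGrad {A B C : ℕ} (x xt : Vec N₂) (a : Fin A → Fin n₂) (b : Fin B → Fin n₂)
    (c : Fin C → Fin n₁) : Vec N₂ :=
  (C : ℝ)⁻¹ • ∑ k, ((P.estJ x xt b).adjoint (gradient (P.F (c k)) (P.estG x xt a))
    - (P.jac xt).adjoint (gradient (P.F (c k)) (P.Gavg xt))) + P.gradf xt

variable {P}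

theorem expect_norm_estG_sub_sq_le [NeZero n₂] (hs : P.IsSmooth LF BF LG BG) {A : ℕ}
    (hA : 0 < A) (x xt : Vec N₂) :
    𝔼 a : Fin A → Fin n₂, ‖P.estG x xt a - P.Gavg x‖ ^ 2 ≤ (BG * ‖x - xt‖) ^ 2 / A := by
  refine le_of_eq_of_le (Finset.expect_congr rfl fun a _ => ?_)
    (expect_norm_sample_mean_sub_mean_sq_le hA (fun j => P.G j x - P.G j xt)
      fun j => hs.norm_G_sub_le j x xt)
  congr 2
  rw [estG, Gavg, Gavg, Finset.sum_sub_distrib (s := Finset.univ) (f := fun j : Fin n₂ => P.G j x),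
    smul_sub _ (∑ j : Fin n₂, P.G j x)]
  abel

/-- The operator norm is not Hilbertian, so the variance identity is applied only after the adjoint
has acted on a fixed vector `w`. This costs a factor `BF` and no dimension factor. -/
theorem expect_norm_estJ_sub_sq_le [NeZero n₂] (hs : P.IsSmooth LF BF LG BG) {B : ℕ}
    (hB : 0 < B) (x xt : Vec N₂) {w : Vec N₁} (hw : ‖w‖ ≤ BF) :
    𝔼 b : Fin B → Fin n₂, ‖(P.estJ x xt b - P.jac x).adjoint w‖ ^ 2
      ≤ (LG * ‖x - xt‖ * BF) ^ 2 / B := by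
  refine le_of_eq_of_le (Finset.expect_congr rfl fun b _ => ?_)
    (expect_norm_sample_mean_sub_mean_sq_le hB
      (fun j => (fderiv ℝ (P.G j) x - fderiv ℝ (P.G j) xt).adjoint w) (K := LG * ‖x - xt‖ * BF)
      fun j => ?_)
  · congr 2
    rw [estJ, map_sub, map_add, _root_.sub_apply, _root_.add_apply,
      adjoint_jac_apply, adjoint_jac_apply]
    simp only [map_sub, _root_.sub_apply, Finset.sum_sub_distrib, smul_sub, map_smulₛₗ,
      map_sum, _root_.smul_apply, _root_.sum_apply, conj_trivial]
    abel
  · refine (ContinuousLinearMap.le_opNorm _ _).trans ?_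
    rw [LinearIsometryEquiv.norm_map]
    have := hs.lip_G j x xt
    have := (norm_nonneg _).trans this
    gcongr

/-- The error is `e₁ + e₂ + e₃`: replace the estimated Jacobian by the true one, then the estimated
inner value by the true one, and what remains is pure sampling of the outer index. -/
theorem expect_norm_estGrad_sub_sq_le [NeZero n₁] [NeZero n₂] (hs : P.IsSmooth LF BF LG BG)
    (hc : P.IsCompSmooth L) {A B C : ℕ} (hA : 0 < A) (hB : 0 < B) (hC : 0 < C) (x xt : Vec N₂) :
    𝔼 a : Fin A → Fin n₂, 𝔼 b : Fin B → Fin n₂, 𝔼 c : Fin C → Fin n₁,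
        ‖P.estGrad x xt a b c - P.gradf x‖ ^ 2
      ≤ 3 * (BF ^ 2 * LG ^ 2 / B + BG ^ 4 * LF ^ 2 / A + L ^ 2 / C) * ‖x - xt‖ ^ 2 := by
  have : NeZero C := ⟨hC.ne'⟩
  have hBG := hs.BG_nonneg
  have hLF := hs.LF_nonneg
  have hpt : ∀ (a : Fin A → Fin n₂) (b : Fin B → Fin n₂) (c : Fin C → Fin n₁),
      ‖P.estGrad x xt a b c - P.gradf x‖ ^ 2
      ≤ 3 * (𝔼 k, ‖(P.estJ x xt b - P.jac x).adjoint (gradient (P.F (c k)) (P.estG x xt a))‖ ^ 2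
        + (BG * LF) ^ 2 * ‖P.estG x xt a - P.Gavg x‖ ^ 2
        + ‖(C : ℝ)⁻¹ • ∑ k, ((P.jac x).adjoint (gradient (P.F (c k)) (P.Gavg x))
            - (P.jac xt).adjoint (gradient (P.F (c k)) (P.Gavg xt)))
          - (n₁ : ℝ)⁻¹ • ∑ i, ((P.jac x).adjoint (gradient (P.F i) (P.Gavg x))
            - (P.jac xt).adjoint (gradient (P.F i) (P.Gavg xt)))‖ ^ 2) := by
    intro a b c
    set e₃ := (C : ℝ)⁻¹ • ∑ k, ((P.jac x).adjoint (gradient (P.F (c k)) (P.Gavg x))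
            - (P.jac xt).adjoint (gradient (P.F (c k)) (P.Gavg xt)))
          - (n₁ : ℝ)⁻¹ • ∑ i, ((P.jac x).adjoint (gradient (P.F i) (P.Gavg x))
            - (P.jac xt).adjoint (gradient (P.F i) (P.Gavg xt))) with he₃
    set e₁ := (C : ℝ)⁻¹ • ∑ k,
      (P.estJ x xt b - P.jac x).adjoint (gradient (P.F (c k)) (P.estG x xt a)) with he₁
    set e₂ := (C : ℝ)⁻¹ • ∑ k, (P.jac x).adjoint
      (gradient (P.F (c k)) (P.estG x xt a) - gradient (P.F (c k)) (P.Gavg x)) with he₂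
    have hsum : P.estGrad x xt a b c - P.gradf x = e₁ + e₂ + e₃ := by
      rw [he₁, he₂, he₃, estGrad, gradf_eq, gradf_eq]
      simp only [map_sub, _root_.sub_apply, Finset.sum_sub_distrib, smul_sub]
      abel
    have h1 : ‖e₁‖ ^ 2 ≤ _ := norm_inv_smul_sum_sq_le _
    have h2 : ‖e₂‖ ≤ BG * LF * ‖P.estG x xt a - P.Gavg x‖ := by
      refine norm_inv_smul_sum_le _ fun k => ?_
      refine (ContinuousLinearMap.le_opNorm _ _).trans ?_
      rw [LinearIsometryEquiv.norm_map, mul_assoc]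
      gcongr
      · exact norm_inv_smul_sum_le _ fun j => hs.bdd_G j x
      · exact hs.lip_F _ _ _
    have h2' : ‖e₂‖ ^ 2 ≤ (BG * LF) ^ 2 * ‖P.estG x xt a - P.Gavg x‖ ^ 2 := by
      rw [← mul_pow]; gcongr
    have h3 : ‖e₁ + e₂ + e₃‖ ^ 2 ≤ 3 * (‖e₁‖ ^ 2 + ‖e₂‖ ^ 2 + ‖e₃‖ ^ 2) := by
      have := norm_add₃_le (a := e₁) (b := e₂) (c := e₃)
      have h0 := norm_nonneg (e₁ + e₂ + e₃)
      nlinarith [sq_nonneg (‖e₁‖ - ‖e₂‖), sq_nonneg (‖e₁‖ - ‖e₃‖), sq_nonneg (‖e₂‖ - ‖e₃‖)]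
    rw [hsum]
    linarith
  have hE1 : ∀ (a : Fin A → Fin n₂) (c : Fin C → Fin n₁), 𝔼 b : Fin B → Fin n₂,
      𝔼 k, ‖(P.estJ x xt b - P.jac x).adjoint (gradient (P.F (c k)) (P.estG x xt a))‖ ^ 2
      ≤ (LG * ‖x - xt‖ * BF) ^ 2 / B := by
    intro a c
    -- The vector that the Jacobian error acts on depends on `a` and `c` only, so averaging over `b`
    -- treats it as fixed.
    rw [Finset.expect_comm]
    exact Finset.expect_le Finset.univ_nonempty fun k _ =>
      expect_norm_estJ_sub_sq_le hs hB x xt (hs.bdd_F _ _)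
  have hE3 := expect_norm_sample_mean_sub_mean_sq_le hC
    (fun i => (P.jac x).adjoint (gradient (P.F i) (P.Gavg x))
            - (P.jac xt).adjoint (gradient (P.F i) (P.Gavg xt))) fun i => hc.norm_jac_sub_le i x xt
  have hE2 := expect_norm_estG_sub_sq_le hs hA x xt
  refine (Finset.expect_le_expect fun a _ => Finset.expect_le_expect fun b _ =>
    Finset.expect_le_expect fun c _ => hpt a b c).trans ?_
  simp only [Finset.expect_add_distrib, ← Finset.mul_expect, Fintype.expect_const]
  have hE1' : 𝔼 a : Fin A → Fin n₂, 𝔼 b : Fin B → Fin n₂, 𝔼 c : Fin C → Fin n₁, 𝔼 k,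
      ‖(P.estJ x xt b - P.jac x).adjoint (gradient (P.F (c k)) (P.estG x xt a))‖ ^ 2
      ≤ (LG * ‖x - xt‖ * BF) ^ 2 / B := by
    refine Finset.expect_le Finset.univ_nonempty fun a _ => ?_
    rw [Finset.expect_comm]
    exact Finset.expect_le Finset.univ_nonempty fun c _ => hE1 a c
  have hE2' := mul_le_mul_of_nonneg_left hE2 (sq_nonneg (BG * LF))
  calc _ ≤ 3 * ((LG * ‖x - xt‖ * BF) ^ 2 / B + (BG * LF) ^ 2 * ((BG * ‖x - xt‖) ^ 2 / A)
        + (L * ‖x - xt‖) ^ 2 / C) := by gcongr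
    _ = _ := by ring

end COP

/-! ### One step of the coupled mirror and gradient descent -/

section Coupling

variable {E : Type*} [NormedAddCommGroup E] [InnerProductSpace ℝ E]

theorem ConvexOn.le_three {s : Set E} {φ : E → ℝ} (h : ConvexOn ℝ s φ) {x y z : E} (hx : x ∈ s)
    (hy : y ∈ s) (hz : z ∈ s) {a b c : ℝ} (ha : 0 ≤ a) (hb : 0 ≤ b) (hc : 0 ≤ c)
    (habc : a + b + c = 1) :
    a • x + b • y + c • z ∈ s ∧ φ (a • x + b • y + c • z) ≤ a * φ x + b * φ y + c * φ z := by
  have h0 : ∀ i ∈ (Finset.univ : Finset (Fin 3)), 0 ≤ ![a, b, c] i := by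
    intro i _; fin_cases i <;> simpa
  have h1 : ∑ i, ![a, b, c] i = 1 := by simpa [Fin.sum_univ_three] using habc
  have h2 : ∀ i ∈ (Finset.univ : Finset (Fin 3)), ![x, y, z] i ∈ s := by
    intro i _; fin_cases i <;> simpa
  have h3 := h.1.sum_mem h0 h1 h2
  have h4 := h.map_sum_le h0 h1 h2
  simp only [Fin.sum_univ_three, Matrix.cons_val_zero, Matrix.cons_val_one, Matrix.cons_val,
    smul_eq_mul] at h3 h4
  exact ⟨h3, h4⟩

theorem norm_coupling_sub_sq_le {x y z xt u : E} {τ : ℝ} (hτ : 0 ≤ τ) (hτ' : 2 * τ ≤ 1)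
    (hx : x = τ • z + τ • xt + (1 - τ - τ) • y) :
    ‖x - xt‖ ^ 2 ≤ 2 * (1 - τ) * (τ * ‖z - u‖ ^ 2 + (1 - 2 * τ) * ‖y - u‖ ^ 2
      + (1 - τ) * ‖xt - u‖ ^ 2) := by
  have h0 : x - xt = τ • ((z - u) - (xt - u)) + (1 - 2 * τ) • ((y - u) - (xt - u)) := by
    rw [hx]; module
  have h1 : ∀ p q : E, ‖p - q‖ ^ 2 ≤ 2 * ‖p‖ ^ 2 + 2 * ‖q‖ ^ 2 := by
    intro p q
    have := parallelogram_law_with_norm ℝ p q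
    nlinarith [sq_nonneg ‖p + q‖]
  have h2 : ∀ p q : E, ‖τ • p + (1 - 2 * τ) • q‖ ^ 2
      ≤ (1 - τ) * (τ * ‖p‖ ^ 2 + (1 - 2 * τ) * ‖q‖ ^ 2) := by
    intro p q
    have h3 : ‖τ • p + (1 - 2 * τ) • q‖ ≤ τ * ‖p‖ + (1 - 2 * τ) * ‖q‖ := by
      refine (norm_add_le _ _).trans (le_of_eq ?_)
      rw [norm_smul, norm_smul, Real.norm_of_nonneg hτ, Real.norm_of_nonneg (by linarith)]
    calc _ ≤ (τ * ‖p‖ + (1 - 2 * τ) * ‖q‖) ^ 2 := by gcongr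
      _ ≤ _ := by nlinarith [mul_nonneg (mul_nonneg hτ (by linarith : 0 ≤ 1 - 2 * τ))
                    (sq_nonneg (‖p‖ - ‖q‖))]
  rw [h0]
  calc _ ≤ _ := h2 _ _
    _ ≤ (1 - τ) * (τ * (2 * ‖z - u‖ ^ 2 + 2 * ‖xt - u‖ ^ 2)
        + (1 - 2 * τ) * (2 * ‖y - u‖ ^ 2 + 2 * ‖xt - u‖ ^ 2)) := by
      have : 0 ≤ 1 - 2 * τ := by linarith
      have : 0 ≤ 1 - τ := by linarith
      gcongr
      · exact h1 _ _
      · exact h1 _ _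
    _ = _ := by ring

variable [CompleteSpace E]

/-- The gradient step is compared with the point obtained from `x` on replacing `z` by `z'`. Its
displacement is `τ • (z' - z)`, so its quadratic cost is exactly `τ` times the proximal term of the
mirror step, and the two cancel. -/
theorem coupling_step_le {f φ : E → ℝ} {gf : E → E} {s : Set E} {L μ τ : ℝ}
    (hf : ConvexOn ℝ Set.univ f) (hgf : ∀ x, HasGradientAt f (gf x) x)
    (hlip : ∀ x y, ‖gf x - gf y‖ ≤ L * ‖x - y‖) (hφ : ConvexOn ℝ s φ) (hL : 0 < L)
    (hτ : 0 < τ) (hτ' : 2 * τ ≤ 1) {x y z xt u g y' z' : E} (hy : y ∈ s)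
    (hxt : xt ∈ s) (hz' : z' ∈ s)
    (hx : x = τ • z + τ • xt + (1 - τ - τ) • y)
    (hmirror : inner ℝ g z' + 3 * τ * L / 2 * ‖z' - z‖ ^ 2 + φ z'
      + (μ + 3 * τ * L) / 2 * ‖u - z'‖ ^ 2 ≤ inner ℝ g u + 3 * τ * L / 2 * ‖u - z‖ ^ 2 + φ u)
    (hgrad : ∀ v ∈ s, inner ℝ g y' + 3 * L / 2 * ‖y' - x‖ ^ 2 + φ y'
      ≤ inner ℝ g v + 3 * L / 2 * ‖v - x‖ ^ 2 + φ v) :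
    (f y' + φ y' - (f u + φ u)) + τ * (μ + 3 * τ * L) / 2 * ‖z' - u‖ ^ 2
      ≤ τ * (f xt + φ xt - (f u + φ u)) + (1 - 2 * τ) * (f y + φ y - (f u + φ u))
        + 3 * τ ^ 2 * L / 2 * ‖z - u‖ ^ 2 + ‖g - gf x‖ ^ 2 / (4 * L)
        - τ * inner ℝ (g - gf x) (z - u) := by
  have hA := le_quadratic_of_lipschitz_gradient hgf hlip x y'
  obtain ⟨hv, hC⟩ := hφ.le_three hz' hxt hy hτ.le hτ.le (by linarith : 0 ≤ 1 - τ - τ) (by ring)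
  have hvx : τ • z' + τ • xt + (1 - τ - τ) • y - x = τ • (z' - z) := by rw [hx]; module
  have hB := hgrad _ hv
  rw [hvx, norm_smul, Real.norm_of_nonneg hτ.le] at hB
  have hEu := hf.add_inner_gradient_le (hgf x) u
  have hEt := mul_le_mul_of_nonneg_left (hf.add_inner_gradient_le (hgf x) xt) hτ.le
  have hEy := mul_le_mul_of_nonneg_left (hf.add_inner_gradient_le (hgf x) y)
    (by linarith : 0 ≤ 1 - 2 * τ)
  -- This `L * ‖y' - x‖²` and the `L / 2` from smoothness together use up the `3 * L / 2` of the
  -- gradient step.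
  have hF : - inner ℝ (g - gf x) (y' - x) ≤ L * ‖y' - x‖ ^ 2 + ‖g - gf x‖ ^ 2 / (4 * L) := by
    have h1 := abs_real_inner_le_norm (g - gf x) (y' - x)
    have h2 := neg_abs_le (inner ℝ (g - gf x) (y' - x))
    have h3 : ‖g - gf x‖ * ‖y' - x‖ ≤ L * ‖y' - x‖ ^ 2 + ‖g - gf x‖ ^ 2 / (4 * L) := by
      have : L * ‖y' - x‖ ^ 2 + ‖g - gf x‖ ^ 2 / (4 * L) - ‖g - gf x‖ * ‖y' - x‖
          = (2 * L * ‖y' - x‖ - ‖g - gf x‖) ^ 2 / (4 * L) := by field_simp; ring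
      have : 0 ≤ (2 * L * ‖y' - x‖ - ‖g - gf x‖) ^ 2 / (4 * L) := by positivity
      linarith
    linarith
  have hgx : inner ℝ g x = τ * inner ℝ g z + τ * inner ℝ g xt + (1 - τ - τ) * inner ℝ g y := by
    conv_lhs => rw [hx]
    simp [inner_add_right, real_inner_smul_right]
  have hfx : inner ℝ (gf x) x = τ * inner ℝ (gf x) z + τ * inner ℝ (gf x) xt
      + (1 - τ - τ) * inner ℝ (gf x) y := by
    conv_lhs => enter [3]; rw [hx]
    simp [inner_add_right, real_inner_smul_right]
  rw [norm_sub_rev u z', norm_sub_rev u z] at hmirror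
  have hD := mul_le_mul_of_nonneg_left hmirror hτ.le
  have hEu' := mul_le_mul_of_nonneg_left hEu hτ.le
  simp only [inner_sub_left, inner_sub_right, inner_add_right, real_inner_smul_right]
    at hA hB hEt hEy hF hEu' ⊢
  linarith

end Coupling

/-! ### Composite problems with a minimizer -/

namespace COP

variable {n₁ n₂ N₁ N₂ : ℕ} {P : COP n₁ n₂ N₁ N₂} {L LF BF LG BG μ : ℝ} {u : Vec N₂}

/-- The real part of the regularizer. -/
noncomputable def hr (P : COP n₁ n₂ N₁ N₂) (x : Vec N₂) : ℝ := (P.h x).toReal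

/-- The effective domain of the regularizer. -/
def dom (P : COP n₁ n₂ N₁ N₂) : Set (Vec N₂) := {x | P.h x ≠ ⊤}

/-- `f` is convex, `h` is proper, closed and `μ`-strongly convex, and `u` is a minimizer of
`f + h`. -/
structure IsComposite (P : COP n₁ n₂ N₁ N₂) (μ : ℝ) (u : Vec N₂) : Prop where
  convex_f : ConvexOn ℝ Set.univ P.f
  h_ne_bot : ∀ x, P.h x ≠ ⊥
  h_closed : LowerSemicontinuous P.h
  strongConvex_h : StrongConvexOn P.dom μ P.hr
  mem_dom : u ∈ P.dom
  isMin : ∀ x, P.H u ≤ P.H x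

namespace IsComposite

theorem h_eq (hP : P.IsComposite μ u) {x : Vec N₂} (hx : x ∈ P.dom) : P.h x = (P.hr x : EReal) :=
  (EReal.coe_toReal hx (hP.h_ne_bot x)).symm

theorem H_eq (hP : P.IsComposite μ u) {x : Vec N₂} (hx : x ∈ P.dom) :
    P.H x = ((P.f x + P.hr x : ℝ) : EReal) := by
  rw [H, hP.h_eq hx, EReal.coe_add]

theorem iInf_H (hP : P.IsComposite μ u) : ⨅ y, P.H y = P.H u :=
  le_antisymm (iInf_le _ _) (le_iInf hP.isMin)

theorem f_add_hr_le (hP : P.IsComposite μ u) {x : Vec N₂} (hx : x ∈ P.dom) :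
    P.f u + P.hr u ≤ P.f x + P.hr x := by
  have := hP.isMin x
  rwa [hP.H_eq hx, hP.H_eq hP.mem_dom, EReal.coe_le_coe_iff] at this

theorem gap_eq (hP : P.IsComposite μ u) {x : Vec N₂} (hx : x ∈ P.dom) :
    P.gap x = ENNReal.ofReal (P.f x + P.hr x - (P.f u + P.hr u)) := by
  rw [gap, hP.iInf_H, hP.H_eq hx, hP.H_eq hP.mem_dom, ← EReal.coe_sub,
    EReal.toENNReal_of_ne_top (EReal.coe_ne_top _), EReal.toReal_coe]

theorem gap_eq_top (hP : P.IsComposite μ u) {x : Vec N₂} (hx : x ∉ P.dom) : P.gap x = ⊤ := by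
  have hx' : P.h x = ⊤ := not_not.1 hx
  rw [gap, hP.iInf_H, hP.H_eq hP.mem_dom, H, hx', EReal.coe_add_top, EReal.top_sub_coe,
    EReal.toENNReal_top]

theorem convexOn_hr (hP : P.IsComposite μ u) (hμ : 0 ≤ μ) : ConvexOn ℝ P.dom P.hr :=
  UniformConvexOn.convexOn hP.strongConvex_h fun r => by positivity

theorem norm_sub_sq_le (hP : P.IsComposite μ u) {x : Vec N₂} (hx : x ∈ P.dom) :
    μ / 2 * ‖x - u‖ ^ 2 ≤ P.f x + P.hr x - (P.f u + P.hr u) := by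
  have h1 : StrongConvexOn P.dom μ (fun x => P.f x + P.hr x) := by
    have h2 := strongConvexOn_zero.2 (hP.convex_f.subset (Set.subset_univ _) hP.strongConvex_h.1)
    refine UniformConvexOn.mono ?_ (h2.add hP.strongConvex_h)
    intro r
    simp
  have := h1.le_sub_of_isMinOn hP.mem_dom hx fun v hv => hP.f_add_hr_le hv
  linarith

/-- Optimality of `u` makes `-∇f(u)` a subgradient of `h` at `u`: a negative directional derivative
would let a short move towards `w` beat `u`. The resulting affine minorant makes the proximal
subproblems coercive, so their minimizers exist. -/
theorem hr_sub_inner_le (hP : P.IsComposite μ u) (hμ : 0 ≤ μ)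
    (hs : P.IsSmooth LF BF LG BG) {w : Vec N₂} (hw : w ∈ P.dom) :
    P.hr u - inner ℝ (P.gradf u) (w - u) ≤ P.hr w := by
  have hder : HasDerivAt (fun t : ℝ => P.f (u + t • (w - u)) + t * (P.hr w - P.hr u))
      (inner ℝ (P.gradf u) (w - u) + 1 * (P.hr w - P.hr u)) 0 :=
    (HasGradientAt.hasDerivAt_line (by simpa using hs.hasGradientAt_f u)).add
      ((hasDerivAt_id _).mul_const _)
  by_contra hlt
  have hneg : inner ℝ (P.gradf u) (w - u) + 1 * (P.hr w - P.hr u) < 0 := by linarith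
  have hslope := hasDerivAt_iff_tendsto_slope.1 hder
  have hev := (hslope.mono_left (nhdsWithin_mono (0 : ℝ) (s := Set.Ioi 0) (t := {0}ᶜ)
    fun t ht => ne_of_gt (Set.mem_Ioi.1 ht))).eventually
    (gt_mem_nhds hneg)
  obtain ⟨t, ht, ht'⟩ := (hev.and (Ioo_mem_nhdsGT zero_lt_one)).exists
  rw [slope_def_field] at ht
  simp only [zero_smul, add_zero, zero_mul, sub_zero] at ht
  have h1 := (hP.convexOn_hr hμ).2 hw hP.mem_dom ht'.1.le (sub_nonneg.2 ht'.2.le)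
    (add_sub_cancel t 1)
  have h2 := hP.f_add_hr_le (hP.strongConvex_h.1 hw hP.mem_dom ht'.1.le (sub_nonneg.2 ht'.2.le)
    (add_sub_cancel t 1))
  have h3 : t • w + (1 - t) • u = u + t • (w - u) := by module
  rw [h3] at h1 h2
  simp only [smul_eq_mul] at h1
  have h4 := (div_lt_iff₀ ht'.1).1 ht
  linarith

theorem prox_le (hP : P.IsComposite μ u) (hμ : 0 ≤ μ)
    (hs : P.IsSmooth LF BF LG BG) {η : ℝ} (hη : 0 < η) (g c : Vec N₂) {z : Vec N₂}
    (hz : z = argmin fun z => ((inner ℝ g z + η / 2 * ‖z - c‖ ^ 2 : ℝ) : EReal) + P.h z) :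
    z ∈ P.dom ∧ ∀ w ∈ P.dom, inner ℝ g z + η / 2 * ‖z - c‖ ^ 2 + P.hr z
      + (μ + η) / 2 * ‖w - z‖ ^ 2 ≤ inner ℝ g w + η / 2 * ‖w - c‖ ^ 2 + P.hr w := by
  set φ : Vec N₂ → EReal :=
    fun z => ((inner ℝ g z + η / 2 * ‖z - c‖ ^ 2 : ℝ) : EReal) + P.h z with hφ
  have hval : ∀ w ∈ P.dom, φ w = ((inner ℝ g w + η / 2 * ‖w - c‖ ^ 2 + P.hr w : ℝ) : EReal) := by
    intro w hw
    simp only [hφ]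
    rw [EReal.coe_add _ (P.hr w), hP.h_eq hw]
  have htop : ∀ w, w ∉ P.dom → φ w = ⊤ := by
    intro w hw
    have hw' : P.h w = ⊤ := not_not.1 hw
    simp only [hφ, hw', EReal.coe_add_top]
  have hlsc : LowerSemicontinuous φ := by
    refine LowerSemicontinuous.add' ?_ hP.h_closed fun x => ?_
    · refine Continuous.lowerSemicontinuous ?_
      exact continuous_coe_real_ereal.comp (by fun_prop)
    · exact EReal.continuousAt_add (.inl (EReal.coe_ne_top _)) (.inl (EReal.coe_ne_bot _))
  set d := g - P.gradf u with hd
  have hlow : ∀ w, ((η / 4 * ‖w - c‖ ^ 2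
      - (‖d‖ ^ 2 / η - inner ℝ g c - P.hr u - inner ℝ (P.gradf u) (u - c)) : ℝ) : EReal)
      ≤ φ w := by
    intro w
    by_cases hw : w ∈ P.dom
    · rw [hval w hw, EReal.coe_le_coe_iff]
      have h1 := hP.hr_sub_inner_le hμ hs hw
      have h2 : -inner ℝ d (w - c) ≤ η / 4 * ‖w - c‖ ^ 2 + ‖d‖ ^ 2 / η := by
        have h1 := abs_real_inner_le_norm d (w - c)
        have h2 := neg_abs_le (inner ℝ d (w - c))
        have h3 : η / 4 * ‖w - c‖ ^ 2 + ‖d‖ ^ 2 / η - ‖d‖ * ‖w - c‖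
          = (η * ‖w - c‖ / 2 - ‖d‖) ^ 2 / η := by field_simp; ring
        have : 0 ≤ (η * ‖w - c‖ / 2 - ‖d‖) ^ 2 / η := by positivity
        linarith
      simp only [hd, inner_sub_left, inner_sub_right] at h1 h2 ⊢
      linarith
    · rw [htop w hw]; exact le_top
  have hmin := argmin_le (exists_forall_le_of_quadratic_le hlsc
    (by rw [hval u hP.mem_dom]; exact EReal.coe_ne_top _) (by positivity : 0 < η / 4) hlow)
  rw [← hz] at hmin
  have hzd : z ∈ P.dom := by
    by_contra h
    have := hmin u
    rw [htop z h, hval u hP.mem_dom] at this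
    exact EReal.coe_ne_top _ (top_le_iff.1 this)
  refine ⟨hzd, fun w hw => ?_⟩
  refine (hP.strongConvex_h.add_inner_add_sq g c η).le_sub_of_isMinOn hzd hw fun v hv => ?_
  have := hmin v
  rwa [hval z hzd, hval v hv, EReal.coe_le_coe_iff] at this

end IsComposite

end COP

/-! ### The expected progress of one inner iteration -/

/-- The error of the gradient estimator is absorbed by the strong convexity. -/
theorem absorb_error {M τ μ L Z Y W Dy Dt V : ℝ} (hM : 1 ≤ M) (hτ : τ = 1 / (2 * M)) (hμ : 0 < μ)
    (hL : 0 < L) (hML : M ^ 2 * μ ≤ L) (hDy : μ / 2 * Y ≤ Dy) (hDt : μ / 2 * W ≤ Dt)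
    (hZ : 0 ≤ Z) (hY : 0 ≤ Y) (hW : 0 ≤ W)
    (hV : V ≤ μ ^ 2 / 180 * (2 * (1 - τ) * (τ * Z + (1 - 2 * τ) * Y + (1 - τ) * W))) :
    τ * Dt + (1 - 2 * τ) * Dy + (1 + 1 / (26 * M)) * (3 * τ ^ 2 * L / 2 * Z)
        + 55 / 12 * (M / L) * V
      ≤ 5 / 4 * τ * Dt + (1 - 7 / 4 * τ) * Dy + (1 + 1 / (13 * M)) * (3 * τ ^ 2 * L / 2 * Z) := by
  have hM0 : 0 < M := by linarith
  have hτ0 : 0 < τ := by rw [hτ]; positivity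
  have hτM : 2 * M * τ = 1 := by rw [hτ]; field_simp
  have hτ1 : 2 * τ ≤ 1 := by nlinarith
  -- From `M ^ 2 * μ ≤ L`, `M * μ / L ≤ 1 / M = 2 * τ`.
  have hcoef : 55 / 12 * (M / L) * (μ ^ 2 / 180) ≤ 55 / 1080 * (μ * τ) := by
    have : μ * τ - M / L * μ ^ 2 / 2 = μ * (L - M ^ 2 * μ) / (2 * M * L) := by
      rw [hτ]; field_simp
    have : 0 ≤ μ * (L - M ^ 2 * μ) / (2 * M * L) := by
      have : 0 ≤ L - M ^ 2 * μ := by linarith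
      positivity
    linarith
  have h1 : 55 / 12 * (M / L) * V ≤ 55 / 1080 * (μ * τ) * (2 * (1 - τ) *
      (τ * Z + (1 - 2 * τ) * Y + (1 - τ) * W)) := by
    calc 55 / 12 * (M / L) * V ≤ 55 / 12 * (M / L) * (μ ^ 2 / 180 * (2 * (1 - τ) *
          (τ * Z + (1 - 2 * τ) * Y + (1 - τ) * W))) := by gcongr
      _ = 55 / 12 * (M / L) * (μ ^ 2 / 180) * (2 * (1 - τ) *
          (τ * Z + (1 - 2 * τ) * Y + (1 - τ) * W)) := by ring
      _ ≤ _ := by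
        have : 0 ≤ 1 - 2 * τ := by linarith
        have : 0 ≤ 1 - τ := by linarith
        gcongr
  -- The share of `z` costs another `1 / (26 * M)`; the shares of `y` and `xt` below cost `τ / 4` of
  -- each gap.
  have hz : 55 / 1080 * (μ * τ) * (2 * (1 - τ) * (τ * Z))
      ≤ 1 / (26 * M) * (3 * τ ^ 2 * L / 2 * Z) := by
    have e1 : 1 / (26 * M) = τ / 13 := by rw [hτ]; field_simp; norm_num
    have e2 : μ ≤ 4 * τ ^ 2 * L := by
      have : 4 * τ ^ 2 * (M ^ 2 * μ) ≤ 4 * τ ^ 2 * L := by gcongr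
      have e3 : 4 * τ ^ 2 * (M ^ 2 * μ) = (2 * M * τ) ^ 2 * μ := by ring
      rw [e3, hτM] at this
      linarith
    have e4 : τ * (1 - τ) ≤ 1 / 4 := by nlinarith [sq_nonneg (1 - 2 * τ)]
    rw [e1]
    have e5 : 55 / 1080 * (2 * (τ * (1 - τ))) * μ ≤ 1 / 13 * (3 * τ ^ 2 * L / 2) := by
      have : 55 / 1080 * (2 * (τ * (1 - τ))) * μ ≤ 55 / 1080 * (2 * (1 / 4)) * μ := by gcongr
      linarith
    have := mul_le_mul_of_nonneg_right e5 (mul_nonneg hτ0.le hZ)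
    linarith
  have hDy0 : 0 ≤ Dy := le_trans (by positivity : 0 ≤ μ / 2 * Y) hDy
  have hDt0 : 0 ≤ Dt := le_trans (by positivity : 0 ≤ μ / 2 * W) hDt
  have hyy : 55 / 1080 * (μ * τ) * (2 * (1 - τ) * ((1 - 2 * τ) * Y)) ≤ τ / 4 * Dy := by
    calc _ = 55 / 270 * ((1 - τ) * (1 - 2 * τ)) * τ * (μ / 2 * Y) := by ring
      _ ≤ 55 / 270 * (1 * 1) * τ * Dy := by
        have : 0 ≤ 1 - 2 * τ := by linarith
        gcongr <;> linarith
      _ ≤ _ := by nlinarith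
  have htt : 55 / 1080 * (μ * τ) * (2 * (1 - τ) * ((1 - τ) * W)) ≤ τ / 4 * Dt := by
    calc _ = 55 / 270 * ((1 - τ) * (1 - τ)) * τ * (μ / 2 * W) := by ring
      _ ≤ 55 / 270 * (1 * 1) * τ * Dt := by
        have : 0 ≤ 1 - τ := by linarith
        gcongr <;> linarith
      _ ≤ _ := by nlinarith
  have e6 : 1 / (13 * M) = 1 / (26 * M) + 1 / (26 * M) := by field_simp; norm_num
  rw [e6]
  linarith

namespace COP

variable {n₁ n₂ N₁ N₂ : ℕ} {P : COP n₁ n₂ N₁ N₂} {L LF BF LG BG μ : ℝ} {u : Vec N₂}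

/-- The result of a proximal step. -/
noncomputable def prox (P : COP n₁ n₂ N₁ N₂) (η : ℝ) (g c : Vec N₂) : Vec N₂ :=
  argmin fun z => ((inner ℝ g z + η / 2 * ‖z - c‖ ^ 2 : ℝ) : EReal) + P.h z

namespace IsComposite

theorem prox_mem (hP : P.IsComposite μ u) (hμ : 0 ≤ μ) (hs : P.IsSmooth LF BF LG BG) {η : ℝ}
    (hη : 0 < η) (g c : Vec N₂) : P.prox η g c ∈ P.dom :=
  (hP.prox_le hμ hs hη g c rfl).1

/-- Strong convexity of the mirror step gains a factor `1 + 1 / (6 * M)` on the new distance. Since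
the estimator is biased, its linear error term is paid for out of this gain. -/
theorem step_le [NeZero n₁] [NeZero n₂] (hP : P.IsComposite μ u) (hμ : 0 < μ)
    (hs : P.IsSmooth LF BF LG BG) (hc : P.IsCompSmooth L) (hL : 0 < L) {M τ : ℝ}
    (hM : 1 ≤ M) (hτ : τ = 1 / (2 * M)) (hLM : L ≤ 4 * M ^ 2 * μ) {x y z xt : Vec N₂}
    (g : Vec N₂) (hy : y ∈ P.dom) (hxt : xt ∈ P.dom) (hx : x = τ • z + τ • xt + (1 - τ - τ) • y) :
    (P.f (P.prox (3 * L) g x) + P.hr (P.prox (3 * L) g x) - (P.f u + P.hr u))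
        + (1 + 1 / (6 * M)) * (3 * τ ^ 2 * L / 2 * ‖P.prox (3 * τ * L) g z - u‖ ^ 2)
      ≤ τ * (P.f xt + P.hr xt - (P.f u + P.hr u))
        + (1 - 2 * τ) * (P.f y + P.hr y - (P.f u + P.hr u))
        + (1 + 1 / (26 * M)) * (3 * τ ^ 2 * L / 2 * ‖z - u‖ ^ 2)
        + 55 / 12 * (M / L) * ‖g - P.gradf x‖ ^ 2 := by
  have hM0 : 0 < M := by linarith
  have hτ0 : 0 < τ := by rw [hτ]; positivity
  have hτM : 2 * M * τ = 1 := by rw [hτ]; field_simp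
  have hτ1 : 2 * τ ≤ 1 := by nlinarith
  obtain ⟨hz', hmir⟩ := hP.prox_le hμ.le hs (η := 3 * τ * L) (by positivity) g z
    (z := P.prox (3 * τ * L) g z) rfl
  obtain ⟨hy', hgr⟩ := hP.prox_le hμ.le hs (η := 3 * L) (by positivity) g x
    (z := P.prox (3 * L) g x) rfl
  have hstep := coupling_step_le hP.convex_f hs.hasGradientAt_f hc.norm_gradf_sub_le
    (hP.convexOn_hr hμ.le) hL hτ0 hτ1 hy hxt hz' hx (hmir u hP.mem_dom)
    (y' := P.prox (3 * L) g x) fun v hv => by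
      refine le_trans ?_ (hgr v hv)
      have : 0 ≤ (μ + 3 * L) / 2 * ‖v - P.prox (3 * L) g x‖ ^ 2 := by positivity
      exact le_add_of_nonneg_right this
  -- Young's inequality, weighted to spend only `1 / (26 * M)` of the gain; the difference of the
  -- two sides is the perfect square in `h3`.
  have hyoung : - (τ * inner ℝ (g - P.gradf x) (z - u))
      ≤ 1 / (26 * M) * (3 * τ ^ 2 * L / 2 * ‖z - u‖ ^ 2)
        + 13 * M / (3 * L) * ‖g - P.gradf x‖ ^ 2 := by
    have h1 := abs_real_inner_le_norm (g - P.gradf x) (z - u)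
    have h2 := neg_abs_le (inner ℝ (g - P.gradf x) (z - u))
    have h3 : 1 / (26 * M) * (3 * τ ^ 2 * L / 2 * ‖z - u‖ ^ 2)
        + 13 * M / (3 * L) * ‖g - P.gradf x‖ ^ 2 - τ * (‖g - P.gradf x‖ * ‖z - u‖)
        = (3 * τ * L * ‖z - u‖ - 26 * M * ‖g - P.gradf x‖) ^ 2 / (156 * M * L) := by
      field_simp; ring
    have h4 : 0 ≤ (3 * τ * L * ‖z - u‖ - 26 * M * ‖g - P.gradf x‖) ^ 2 / (156 * M * L) := by
      positivity
    have h5 : τ * -inner ℝ (g - P.gradf x) (z - u) ≤ τ * (‖g - P.gradf x‖ * ‖z - u‖) := by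
      gcongr; linarith
    linarith
  -- Equivalent to `L ≤ 4 * M ^ 2 * μ`, so `M` must not be too small; absorbing the variance needs
  -- the opposite bound.
  have hcoef : (1 + 1 / (6 * M)) * (3 * τ ^ 2 * L / 2) ≤ τ * (μ + 3 * τ * L) / 2 := by
    have : 3 * τ ^ 2 * L / 2 * (1 / (6 * M)) ≤ τ * μ / 2 := by
      rw [hτ]
      field_simp
      linarith
    linarith
  have hcoef' := mul_le_mul_of_nonneg_right hcoef (sq_nonneg ‖P.prox (3 * τ * L) g z - u‖)
  have herr : ‖g - P.gradf x‖ ^ 2 / (4 * L) + 13 * M / (3 * L) * ‖g - P.gradf x‖ ^ 2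
      ≤ 55 / 12 * (M / L) * ‖g - P.gradf x‖ ^ 2 := by
    have h1 : 55 / 12 * (M / L) * ‖g - P.gradf x‖ ^ 2 - (‖g - P.gradf x‖ ^ 2 / (4 * L)
        + 13 * M / (3 * L) * ‖g - P.gradf x‖ ^ 2) = (M - 1) / (4 * L) * ‖g - P.gradf x‖ ^ 2 := by
      field_simp; ring
    have h2 : 0 ≤ (M - 1) / (4 * L) * ‖g - P.gradf x‖ ^ 2 := by
      have : 0 ≤ M - 1 := by linarith
      positivity
    linarith
  linarith

theorem expect_step_le [NeZero n₁] [NeZero n₂] (hP : P.IsComposite μ u) (hμ : 0 < μ)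
    (hs : P.IsSmooth LF BF LG BG) (hc : P.IsCompSmooth L) (hL : 0 < L) {M τ : ℝ}
    (hM : 1 ≤ M) (hτ : τ = 1 / (2 * M)) (hML : M ^ 2 * μ ≤ L) (hLM : L ≤ 4 * M ^ 2 * μ)
    {A B C : ℕ} (hA : 0 < A) (hB : 0 < B) (hC : 0 < C)
    (hA' : BG ^ 4 * LF ^ 2 / A ≤ μ ^ 2 / 2160) (hB' : BF ^ 2 * LG ^ 2 / B ≤ μ ^ 2 / 2160)
    (hC' : L ^ 2 / C ≤ μ ^ 2 / 1080) {x y z xt : Vec N₂}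
    (hy : y ∈ P.dom) (hxt : xt ∈ P.dom) (hx : x = τ • z + τ • xt + (1 - τ - τ) • y) :
    𝔼 a : Fin A → Fin n₂, 𝔼 b : Fin B → Fin n₂, 𝔼 c : Fin C → Fin n₁,
      ((P.f (P.prox (3 * L) (P.estGrad x xt a b c) x)
          + P.hr (P.prox (3 * L) (P.estGrad x xt a b c) x) - (P.f u + P.hr u))
        + (1 + 1 / (6 * M))
          * (3 * τ ^ 2 * L / 2 * ‖P.prox (3 * τ * L) (P.estGrad x xt a b c) z - u‖ ^ 2))
      ≤ 5 / 4 * τ * (P.f xt + P.hr xt - (P.f u + P.hr u))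
        + (1 - 7 / 4 * τ) * (P.f y + P.hr y - (P.f u + P.hr u))
        + (1 + 1 / (13 * M)) * (3 * τ ^ 2 * L / 2 * ‖z - u‖ ^ 2) := by
  have hM0 : 0 < M := by linarith
  have hτ0 : 0 < τ := by rw [hτ]; positivity
  have hτM : 2 * M * τ = 1 := by rw [hτ]; field_simp
  have hτ1 : 2 * τ ≤ 1 := by nlinarith
  refine (Finset.expect_le_expect fun a _ => Finset.expect_le_expect fun b _ =>
    Finset.expect_le_expect fun c _ =>
      hP.step_le hμ hs hc hL hM hτ hLM (P.estGrad x xt a b c) hy hxt hx).trans ?_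
  simp only [Finset.expect_add_distrib, ← Finset.mul_expect, Fintype.expect_const]
  have hvar := expect_norm_estGrad_sub_sq_le hs hc hA hB hC x xt
  set V := 𝔼 a : Fin A → Fin n₂, 𝔼 b : Fin B → Fin n₂, 𝔼 c : Fin C → Fin n₁,
        ‖P.estGrad x xt a b c - P.gradf x‖ ^ 2 with hV
  -- `3 * (1 / 2160 + 1 / 2160 + 1 / 1080) = 1 / 180`.
  have hvar' : V ≤ μ ^ 2 / 180 * ‖x - xt‖ ^ 2 := by
    refine hvar.trans ?_
    gcongr
    linarith
  have hd := norm_coupling_sub_sq_le (u := u) hτ0.le hτ1 hx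
  have hDy := hP.norm_sub_sq_le hy
  have hDt := hP.norm_sub_sq_le hxt
  exact absorb_error hM hτ hμ hL hML hDy hDt (sq_nonneg _) (sq_nonneg _) (sq_nonneg _)
    (hvar'.trans (by gcongr))

end IsComposite

end COP

/-! ### The law and the cost of the building blocks of SoCK -/

section Blocks

variable {n₁ n₂ N₁ N₂ : ℕ}

/-- The snapshot at `x`. -/
noncomputable def COP.snapshot (P : COP n₁ n₂ N₁ N₂) (x : Vec N₂) : Snapshot N₁ N₂ :=
  { x := x, G := P.Gavg x, J := P.jac x, g := P.gradf x }

theorem takeSnapshot_eq (P : COP n₁ n₂ N₁ N₂) (x : Vec N₂) :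
    takeSnapshot P x = Alg.charged (P.snapshot x) (2 * n₂ + n₁) := by
  unfold takeSnapshot
  simp only [COP.callG, COP.callJ, COP.callF, Alg.call_eq, Alg.pure_eq, Alg.sum_charged,
    Alg.charged_bind_charged]
  have : n₂ * 1 + (n₂ * 1 + (n₁ * 1 + 0)) = 2 * n₂ + n₁ := by ring
  rw [this]
  rfl

variable [NeZero n₁] [NeZero n₂] (P : COP n₁ n₂ N₁ N₂) (p : SoCKParams)

theorem expect_innerStep (xt : Vec N₂) (j : ℕ) (s : InnerState N₂) (φ : InnerState N₂ → ℝ≥0∞) :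
    expect (innerStep P p (P.snapshot xt) j s).law φ =
      expect (PMF.uniformOfFintype (Fin p.A → Fin n₂)) fun a =>
      expect (PMF.uniformOfFintype (Fin p.B → Fin n₂)) fun b =>
      expect (PMF.uniformOfFintype (Fin p.C → Fin n₁)) fun c =>
        let x := p.τ₁ • s.z + p.τ₂ • xt + (1 - p.τ₁ - p.τ₂) • s.y
        let g := P.estGrad x xt a b c
        φ { y := P.prox (3 * p.L) g x, z := P.prox (1 / p.α) g s.z,
            acc := s.acc + p.θ ^ j • P.prox (3 * p.L) g x } := by
  unfold innerStep
  simp only [COP.callG, COP.callJ, COP.callF, COP.callProx, Alg.call_eq, Alg.pure_eq,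
    Alg.charged_bind_charged, Alg.sum_charged, Alg.expect_law_bind, Alg.expect_law_charged,
    Alg.law_uniform]
  rfl

theorem costLe_innerStep (snap : Snapshot N₁ N₂) (j : ℕ) (s : InnerState N₂) :
    (innerStep P p snap j s).CostLe (2 * p.A + 2 * p.B + 2 * p.C + 2) := by
  unfold innerStep
  simp only [COP.callG, COP.callJ, COP.callF, COP.callProx, Alg.call_eq, Alg.pure_eq,
    Alg.charged_bind_charged, Alg.sum_charged]
  refine Alg.CostLe.mono ((Alg.costLe_uniform _).bind fun a => (Alg.costLe_uniform _).bind fun b =>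
    (Alg.costLe_charged _ _).bind fun dG => (Alg.costLe_charged _ _).bind fun dJ =>
    (Alg.costLe_uniform _).bind fun c => Alg.costLe_charged _ _) ?_
  ring_nf
  omega

theorem costLe_epoch (s : OuterState N₂) :
    (epoch P p s).CostLe (2 * n₂ + n₁ + p.m * (2 * p.A + 2 * p.B + 2 * p.C + 2)) := by
  unfold epoch
  rw [takeSnapshot_eq]
  refine Alg.CostLe.mono ((Alg.costLe_charged _ _).bind fun snap =>
    (Alg.CostLe.loop (fun j s => costLe_innerStep P p snap j s) _ _).bind fun r =>
      Alg.costLe_charged _ 0) ?_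
  simp

theorem costLe_sock (S : ℕ) (x : Vec N₂) :
    (sock P p S x).CostLe
      (S * (2 * n₂ + n₁ + p.m * (2 * p.A + 2 * p.B + 2 * p.C + 2))) := by
  unfold sock
  refine Alg.CostLe.mono ((Alg.CostLe.loop (fun _ s => costLe_epoch P p s) _ _).bind fun r =>
      Alg.costLe_charged _ 0) ?_
  simp

end Blocks

/-! ### The parameters of SoCK -/

section Params

variable {L LF BF LG BG μ : ℝ}

theorem sockParams_m_pos (hμ : 0 < μ) (hμL : μ ≤ L) : 0 < (sockParams L LF BF LG BG μ).m := by
  have hL := hμ.trans_le hμL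
  exact Nat.ceil_pos.2 (by positivity)

theorem le_sockParams_m_sq (hμ : 0 < μ) (hμL : μ ≤ L) :
    L ≤ 4 * ((sockParams L LF BF LG BG μ).m : ℝ) ^ 2 * μ := by
  have hL := hμ.trans_le hμL
  have h1 : 1 / 2 * √(L / μ) ≤ ((sockParams L LF BF LG BG μ).m : ℝ) := Nat.le_ceil _
  have h2 : L / μ ≤ (2 * ((sockParams L LF BF LG BG μ).m : ℝ)) ^ 2 := by
    rw [← Real.sqrt_le_left (by positivity)]
    linarith
  rw [div_le_iff₀ hμ] at h2
  linarith

theorem sockParams_m_sq_le (hμ : 0 < μ) (hμL : μ ≤ L) :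
    ((sockParams L LF BF LG BG μ).m : ℝ) ^ 2 * μ ≤ L := by
  have hL := hμ.trans_le hμL
  set m := (sockParams L LF BF LG BG μ).m with hm
  have h1 : (m : ℝ) < 1 / 2 * √(L / μ) + 1 := Nat.ceil_lt_add_one (by positivity)
  have h2 : (1 : ℝ) ≤ √(L / μ) := by
    rw [Real.one_le_sqrt, one_le_div hμ]; exact hμL
  -- Rounding up at most doubles: `m = 1` is covered by `√(L / μ) ≥ 1`, and for `m ≥ 2` one has `m -
  -- 1 ≥ m / 2`.
  have h3 : (m : ℝ) ≤ √(L / μ) := by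
    rcases Nat.lt_or_ge m 2 with h | h
    · have : (m : ℝ) ≤ 1 := by exact_mod_cast Nat.le_of_lt_succ h
      linarith
    · have : (2 : ℝ) ≤ m := by exact_mod_cast h
      linarith
  have h4 : (m : ℝ) ^ 2 ≤ L / μ := by
    rw [← Real.sq_sqrt (by positivity : 0 ≤ L / μ)]
    gcongr
  rwa [le_div_iff₀ hμ] at h4

theorem div_max_one_ceil_le {a c μ : ℝ} (hc : 0 < c) (hμ : 0 < μ) :
    a / ((max 1 ⌈c * a / μ ^ 2⌉₊ : ℕ) : ℝ) ≤ μ ^ 2 / c := by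
  have h1 : c * a / μ ^ 2 ≤ ((max 1 ⌈c * a / μ ^ 2⌉₊ : ℕ) : ℝ) :=
    (Nat.le_ceil _).trans (by exact_mod_cast le_max_right _ _)
  have h2 : (0 : ℝ) < ((max 1 ⌈c * a / μ ^ 2⌉₊ : ℕ) : ℝ) := by
    exact_mod_cast lt_of_lt_of_le one_pos (le_max_left _ _)
  rw [div_le_iff₀ (by positivity)] at h1
  rw [div_le_div_iff₀ h2 hc]
  linarith

end Params

theorem expect_uniformOfFintype₃ {α β γ : Type} [Fintype α] [Nonempty α] [Fintype β] [Nonempty β]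
    [Fintype γ] [Nonempty γ] (ψ : α → β → γ → ℝ) (h : ∀ a b c, 0 ≤ ψ a b c) :
    (expect (PMF.uniformOfFintype α) fun a => expect (PMF.uniformOfFintype β) fun b =>
      expect (PMF.uniformOfFintype γ) fun c => ENNReal.ofReal (ψ a b c))
      = ENNReal.ofReal (𝔼 a, 𝔼 b, 𝔼 c, ψ a b c) := by
  have h1 : ∀ a b, 0 ≤ 𝔼 c, ψ a b c := fun a b => Finset.expect_nonneg fun c _ => h a b c
  have h2 : ∀ a, 0 ≤ 𝔼 b, 𝔼 c, ψ a b c := fun a => Finset.expect_nonneg fun b _ => h1 a b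
  simp only [expect_uniformOfFintype _ (h _ _), expect_uniformOfFintype _ (h1 _),
    expect_uniformOfFintype _ h2]

/-! ### The potential function -/

namespace COP

variable {n₁ n₂ N₁ N₂ : ℕ} {P : COP n₁ n₂ N₁ N₂} {L LF BF LG BG μ : ℝ} {u : Vec N₂}

open Classical in
/-- The perspective `Θ · gap (v / Θ)` of the optimality gap. -/
noncomputable def wgap (P : COP n₁ n₂ N₁ N₂) (Θ : ℝ) (v : Vec N₂) : ℝ≥0∞ :=
  if Θ = 0 then (if v = 0 then 0 else ⊤) else ENNReal.ofReal Θ * P.gap (Θ⁻¹ • v)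

namespace IsComposite

theorem gap_convex (hP : P.IsComposite μ u) (hμ : 0 ≤ μ) {x y : Vec N₂} {a b : ℝ} (ha : 0 < a)
    (hb : 0 < b) (hab : a + b = 1) :
    P.gap (a • x + b • y) ≤ ENNReal.ofReal a * P.gap x + ENNReal.ofReal b * P.gap y := by
  by_cases hx : x ∈ P.dom
  · by_cases hy : y ∈ P.dom
    · have h1 := (hP.convexOn_hr hμ).2 hx hy ha.le hb.le hab
      have h2 := hP.convex_f.2 (Set.mem_univ x) (Set.mem_univ y) ha.le hb.le hab
      have hx0 := hP.f_add_hr_le hx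
      have hy0 := hP.f_add_hr_le hy
      rw [hP.gap_eq (hP.strongConvex_h.1 hx hy ha.le hb.le hab), hP.gap_eq hx, hP.gap_eq hy,
        ← ENNReal.ofReal_mul ha.le, ← ENNReal.ofReal_mul hb.le, ← ENNReal.ofReal_add
          (mul_nonneg ha.le (sub_nonneg.2 hx0)) (mul_nonneg hb.le (sub_nonneg.2 hy0))]
      refine ENNReal.ofReal_le_ofReal ?_
      simp only [smul_eq_mul] at h1 h2
      obtain rfl : b = 1 - a := by linarith
      linarith
    · rw [hP.gap_eq_top hy, ENNReal.mul_top (by simpa using hb)]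
      simp
  · rw [hP.gap_eq_top hx, ENNReal.mul_top (by simpa using ha)]
    simp

/-- The perspective of a convex function is subadditive. The convention at `Θ = 0` lets the
accumulator start from zero without a special first step. -/
theorem wgap_add_le (hP : P.IsComposite μ u) (hμ : 0 ≤ μ) {Θ w : ℝ} (hΘ : 0 ≤ Θ) (hw : 0 < w)
    (v y : Vec N₂) :
    P.wgap (Θ + w) (v + w • y) ≤ P.wgap Θ v + ENNReal.ofReal w * P.gap y := by
  rcases hΘ.eq_or_lt with rfl | hΘ
  · by_cases hv : v = 0
    · simp [wgap, hv, hw.ne', smul_smul]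
    · simp [wgap, hv]
  · have hs : 0 < Θ + w := by positivity
    have h1 : (Θ + w)⁻¹ • (v + w • y) = (Θ / (Θ + w)) • (Θ⁻¹ • v) + (w / (Θ + w)) • y := by
      rw [smul_smul, smul_add, smul_smul]
      congr 2 <;> field_simp
    have h2 := hP.gap_convex hμ (x := Θ⁻¹ • v) (y := y) (div_pos hΘ hs) (div_pos hw hs)
      (by field_simp)
    simp only [wgap, hs.ne', hΘ.ne', if_false]
    rw [h1]
    calc _ ≤ ENNReal.ofReal (Θ + w) * _ := mul_le_mul_right h2 _
      _ = _ := by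
        rw [mul_add, ← mul_assoc, ← mul_assoc, ← ENNReal.ofReal_mul hs.le,
          ← ENNReal.ofReal_mul hs.le, mul_div_cancel₀ _ hs.ne', mul_div_cancel₀ _ hs.ne']

theorem expect_step_gap_le [NeZero n₁] [NeZero n₂] (hP : P.IsComposite μ u) (hμ : 0 < μ)
    (hs : P.IsSmooth LF BF LG BG) (hc : P.IsCompSmooth L) (hL : 0 < L) {M τ : ℝ}
    (hM : 1 ≤ M) (hτ : τ = 1 / (2 * M)) (hML : M ^ 2 * μ ≤ L) (hLM : L ≤ 4 * M ^ 2 * μ)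
    {A B C : ℕ} (hA : 0 < A) (hB : 0 < B) (hC : 0 < C)
    (hA' : BG ^ 4 * LF ^ 2 / A ≤ μ ^ 2 / 2160) (hB' : BF ^ 2 * LG ^ 2 / B ≤ μ ^ 2 / 2160)
    (hC' : L ^ 2 / C ≤ μ ^ 2 / 1080) {x y z xt : Vec N₂}
    (hx : x = τ • z + τ • xt + (1 - τ - τ) • y) :
    (expect (PMF.uniformOfFintype (Fin A → Fin n₂)) fun a =>
      expect (PMF.uniformOfFintype (Fin B → Fin n₂)) fun b =>
      expect (PMF.uniformOfFintype (Fin C → Fin n₁)) fun c =>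
        P.gap (P.prox (3 * L) (P.estGrad x xt a b c) x)
        + ENNReal.ofReal ((1 + 1 / (6 * M))
          * (3 * τ ^ 2 * L / 2 * ‖P.prox (3 * τ * L) (P.estGrad x xt a b c) z - u‖ ^ 2)))
      ≤ ENNReal.ofReal (5 / 4 * τ) * P.gap xt + (ENNReal.ofReal (1 - 7 / 4 * τ) * P.gap y
        + ENNReal.ofReal ((1 + 1 / (13 * M)) * (3 * τ ^ 2 * L / 2 * ‖z - u‖ ^ 2))) := by
  have hM0 : 0 < M := by linarith
  have hτ0 : 0 < τ := by rw [hτ]; positivity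
  have hτM : 2 * M * τ = 1 := by rw [hτ]; field_simp
  have hτ1 : 2 * τ ≤ 1 := by nlinarith
  have hb : 0 < 1 - 7 / 4 * τ := by linarith
  -- Off the domain the right side is `⊤`, as both gap coefficients are positive.
  by_cases hxt : xt ∈ P.dom
  swap
  · rw [hP.gap_eq_top hxt, ENNReal.mul_top (by simpa using hτ0)]
    simp
  by_cases hy : y ∈ P.dom
  swap
  · rw [hP.gap_eq_top hy, ENNReal.mul_top (by simpa using hb)]
    simp
  have hstep := hP.expect_step_le hμ hs hc hL hM hτ hML hLM hA hB hC hA' hB' hC' hy hxt hx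
  have hy' : ∀ g, 0 ≤ P.f (P.prox (3 * L) g x) + P.hr (P.prox (3 * L) g x)
      - (P.f u + P.hr u) := fun g =>
    sub_nonneg.2 (hP.f_add_hr_le (hP.prox_mem hμ.le hs (by positivity) g x))
  have hz' : ∀ w : Vec N₂, 0 ≤ (1 + 1 / (6 * M)) * (3 * τ ^ 2 * L / 2 * ‖w - u‖ ^ 2) :=
    fun w => by positivity
  have hgap : ∀ g, P.gap (P.prox (3 * L) g x) = ENNReal.ofReal (P.f (P.prox (3 * L) g x)
      + P.hr (P.prox (3 * L) g x) - (P.f u + P.hr u)) := fun g =>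
    hP.gap_eq (hP.prox_mem hμ.le hs (by positivity) g x)
  simp only [hgap, ← ENNReal.ofReal_add (hy' _) (hz' _)]
  have hnn : ∀ a b c, 0 ≤ (P.f (P.prox (3 * L) (P.estGrad x xt (A := A) (B := B) (C := C) a b c) x)
          + P.hr (P.prox (3 * L) (P.estGrad x xt a b c) x) - (P.f u + P.hr u))
        + (1 + 1 / (6 * M))
          * (3 * τ ^ 2 * L / 2 * ‖P.prox (3 * τ * L) (P.estGrad x xt a b c) z - u‖ ^ 2) :=
    fun a b c => add_nonneg (hy' _) (hz' _)
  rw [expect_uniformOfFintype₃ _ hnn]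
  have hDt := sub_nonneg.2 (hP.f_add_hr_le hxt)
  have hDy := sub_nonneg.2 (hP.f_add_hr_le hy)
  rw [hP.gap_eq hxt, hP.gap_eq hy, ← ENNReal.ofReal_mul (by positivity),
    ← ENNReal.ofReal_mul hb.le, ← ENNReal.ofReal_add (by positivity) (by positivity),
    ← ENNReal.ofReal_add (by positivity) (by positivity)]
  exact ENNReal.ofReal_le_ofReal (by linarith)

end IsComposite

end COP

/-! ### Contraction of the potential over an iteration, an epoch and a run of SoCK -/

namespace COP

variable {n₁ n₂ N₁ N₂ : ℕ} {P : COP n₁ n₂ N₁ N₂} {L LF BF LG BG μ : ℝ} {u : Vec N₂}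

/-- The part of the potential that depends on the iterates `y` and `z`. -/
noncomputable def pairPot (P : COP n₁ n₂ N₁ N₂) (p : SoCKParams) (u y z : Vec N₂) : ℝ≥0∞ :=
  ENNReal.ofReal (1 - 7 / 4 * p.τ₁) * P.gap y
    + ENNReal.ofReal ((1 + 1 / (13 * p.m)) * (3 * p.τ₁ ^ 2 * p.L / 2 * ‖z - u‖ ^ 2))

/-- The potential of the inner loop after `j` iterations. -/
noncomputable def innerPot (P : COP n₁ n₂ N₁ N₂) (p : SoCKParams) (u : Vec N₂) (j : ℕ)
    (s : InnerState N₂) : ℝ≥0∞ :=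
  ENNReal.ofReal (19 / 12 * p.τ₁) * P.wgap (∑ i ∈ Finset.range j, p.θ ^ i) s.acc
    + ENNReal.ofReal (p.θ ^ j) * P.pairPot p u s.y s.z

/-- The potential of the outer loop. -/
noncomputable def outerPot (P : COP n₁ n₂ N₁ N₂) (p : SoCKParams) (u : Vec N₂)
    (s : OuterState N₂) : ℝ≥0∞ :=
  ENNReal.ofReal (5 / 4 * p.τ₁ * ∑ i ∈ Finset.range p.m, p.θ ^ i) * P.gap s.xt
    + P.pairPot p u s.y s.z

namespace IsComposite

/-- The gap at the new `y'` pays twice: once for entering the average, once for the next iteration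
with weight `θ`. The constants make both fit into a single copy. -/
theorem innerPot_succ_le (hP : P.IsComposite μ u) (hμ : 0 ≤ μ) {p : SoCKParams}
    (hL : 0 ≤ p.L) (hm : 0 < p.m)
    (hτ : p.τ₁ = 1 / (2 * p.m)) (hθ : p.θ = 1 + 1 / (12 * p.m)) (j : ℕ) (v y' z' : Vec N₂) :
    P.innerPot p u (j + 1) { y := y', z := z', acc := v + p.θ ^ j • y' }
      ≤ ENNReal.ofReal (19 / 12 * p.τ₁) * P.wgap (∑ i ∈ Finset.range j, p.θ ^ i) v
        + ENNReal.ofReal (p.θ ^ j) * (P.gap y'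
          + ENNReal.ofReal ((1 + 1 / (6 * p.m)) * (3 * p.τ₁ ^ 2 * p.L / 2 * ‖z' - u‖ ^ 2))) := by
  have hM : (1 : ℝ) ≤ p.m := by exact_mod_cast hm
  have hM0 : (0 : ℝ) < p.m := by linarith
  have hτ0 : 0 < p.τ₁ := by rw [hτ]; positivity
  have hτM : 2 * p.m * p.τ₁ = 1 := by rw [hτ]; field_simp
  have hτ1 : 2 * p.τ₁ ≤ 1 := by nlinarith
  have hθ0 : 0 < p.θ := by rw [hθ]; positivity
  have hb : 0 ≤ 1 - 7 / 4 * p.τ₁ := by linarith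
  have hθτ : p.θ = 1 + p.τ₁ / 6 := by rw [hθ, hτ]; field_simp; ring
  have h1 := hP.wgap_add_le hμ (Finset.sum_nonneg fun i _ => (pow_pos hθ0 i).le)
    (pow_pos hθ0 j) v y' (Θ := ∑ i ∈ Finset.range j, p.θ ^ i)
  -- As `θ = 1 + τ₁ / 6` and `19 / 12 = 7 / 4 - 1 / 6`, the sum is `1 - 7 * τ₁ ^ 2 / 24`.
  have h2 : ENNReal.ofReal (19 / 12 * p.τ₁) + ENNReal.ofReal p.θ * ENNReal.ofReal (1 - 7 / 4 * p.τ₁)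
      ≤ 1 := by
    rw [← ENNReal.ofReal_mul hθ0.le, ← ENNReal.ofReal_add (by positivity) (by positivity),
      ENNReal.ofReal_le_one, hθτ]
    nlinarith
  have h3 : ENNReal.ofReal p.θ
        * ENNReal.ofReal ((1 + 1 / (13 * p.m)) * (3 * p.τ₁ ^ 2 * p.L / 2 * ‖z' - u‖ ^ 2))
      ≤ ENNReal.ofReal ((1 + 1 / (6 * p.m)) * (3 * p.τ₁ ^ 2 * p.L / 2 * ‖z' - u‖ ^ 2)) := by
    rw [← ENNReal.ofReal_mul hθ0.le, ← mul_assoc]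
    refine ENNReal.ofReal_le_ofReal (mul_le_mul_of_nonneg_right ?_ (by positivity))
    -- Here `1 / 12 + 1 / 13 = 25 / 156` falls short of `1 / 6 = 26 / 156` by just enough for the
    -- quadratic term.
    have : 1 + 1 / (6 * p.m) - p.θ * (1 + 1 / (13 * p.m)) = ((p.m : ℝ) - 1) / (156 * p.m ^ 2) := by
      rw [hθ]; field_simp; ring
    have : 0 ≤ ((p.m : ℝ) - 1) / (156 * p.m ^ 2) := div_nonneg (by linarith) (by positivity)
    linarith
  simp only [innerPot, pairPot, Finset.sum_range_succ]
  rw [pow_succ, ENNReal.ofReal_mul (pow_pos hθ0 j).le]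
  calc _ ≤ ENNReal.ofReal (19 / 12 * p.τ₁) * (P.wgap (∑ i ∈ Finset.range j, p.θ ^ i) v
          + ENNReal.ofReal (p.θ ^ j) * P.gap y') + ENNReal.ofReal (p.θ ^ j) * ENNReal.ofReal p.θ *
          (ENNReal.ofReal (1 - 7 / 4 * p.τ₁) * P.gap y'
            + ENNReal.ofReal ((1 + 1 / (13 * p.m)) * (3 * p.τ₁ ^ 2 * p.L / 2 * ‖z' - u‖ ^ 2))) := by
        gcongr
    _ = ENNReal.ofReal (19 / 12 * p.τ₁) * P.wgap (∑ i ∈ Finset.range j, p.θ ^ i) v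
        + ENNReal.ofReal (p.θ ^ j) * ((ENNReal.ofReal (19 / 12 * p.τ₁)
            + ENNReal.ofReal p.θ * ENNReal.ofReal (1 - 7 / 4 * p.τ₁)) * P.gap y'
          + ENNReal.ofReal p.θ * ENNReal.ofReal
            ((1 + 1 / (13 * p.m)) * (3 * p.τ₁ ^ 2 * p.L / 2 * ‖z' - u‖ ^ 2))) := by ring
    _ ≤ _ := by
        gcongr
        exact (mul_le_mul_left h2 _).trans (one_mul _).le

variable [NeZero n₁] [NeZero n₂]

theorem expect_innerPot_le (hP : P.IsComposite μ u) (hμ : 0 < μ) (hμL : μ ≤ L)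
    (hs : P.IsSmooth LF BF LG BG) (hc : P.IsCompSmooth L) {p : SoCKParams}
    (hp : p = sockParams L LF BF LG BG μ) (xt : Vec N₂) (j : ℕ) (s : InnerState N₂) :
    expect (innerStep P p (P.snapshot xt) j s).law (P.innerPot p u (j + 1))
      ≤ P.innerPot p u j s + ENNReal.ofReal (5 / 4 * p.τ₁ * p.θ ^ j) * P.gap xt := by
  have hL : 0 < L := hμ.trans_le hμL
  have hm : 0 < p.m := hp ▸ sockParams_m_pos hμ hμL
  have hM : (1 : ℝ) ≤ p.m := by exact_mod_cast hm
  have hpL : p.L = L := by rw [hp]; rfl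
  have hτ : p.τ₁ = 1 / (2 * p.m) := by rw [hp]; rfl
  have hτ₂ : p.τ₂ = p.τ₁ := by rw [hp]; rfl
  have hα : 1 / p.α = 3 * p.τ₁ * L := by rw [hp]; exact one_div_one_div _
  have hθ : p.θ = 1 + 1 / (12 * p.m) := by rw [hp]; rfl
  have hθ0 : 0 < p.θ := by rw [hθ]; positivity
  have hτ0 : 0 < p.τ₁ := by rw [hτ]; positivity
  have hA : 0 < p.A := by rw [hp]; exact lt_of_lt_of_le one_pos (le_max_left _ _)
  have hB : 0 < p.B := by rw [hp]; exact lt_of_lt_of_le one_pos (le_max_left _ _)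
  have hC : 0 < p.C := by rw [hp]; exact lt_of_lt_of_le one_pos (le_max_left _ _)
  have hA' : BG ^ 4 * LF ^ 2 / p.A ≤ μ ^ 2 / 2160 := by
    rw [hp]
    simp only [sockParams, mul_assoc (2160 : ℝ)]
    exact div_max_one_ceil_le (by norm_num) hμ
  have hB' : BF ^ 2 * LG ^ 2 / p.B ≤ μ ^ 2 / 2160 := by
    rw [hp]
    simp only [sockParams, mul_assoc (2160 : ℝ)]
    exact div_max_one_ceil_le (by norm_num) hμ
  have hC' : L ^ 2 / p.C ≤ μ ^ 2 / 1080 := by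
    rw [hp]
    exact div_max_one_ceil_le (by norm_num) hμ
  have hstep := hP.expect_step_gap_le hμ hs hc hL hM hτ (hp ▸ sockParams_m_sq_le hμ hμL)
    (hp ▸ le_sockParams_m_sq hμ hμL) hA hB hC hA' hB' hC' (z := s.z) (y := s.y) (xt := xt) rfl
  rw [expect_innerStep]
  simp only [hα, hpL, hτ₂]
  refine (expect_mono _ fun a => expect_mono _ fun b => expect_mono _ fun c =>
    hP.innerPot_succ_le hμ.le (by rw [hpL]; exact hL.le) hm hτ hθ j s.acc _ _).trans ?_
  simp only [expect_add, expect_const, expect_const_mul] at hstep ⊢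
  rw [hpL]
  calc _ ≤ ENNReal.ofReal (19 / 12 * p.τ₁) * P.wgap (∑ i ∈ Finset.range j, p.θ ^ i) s.acc
        + ENNReal.ofReal (p.θ ^ j) * (ENNReal.ofReal (5 / 4 * p.τ₁) * P.gap xt
          + (ENNReal.ofReal (1 - 7 / 4 * p.τ₁) * P.gap s.y + ENNReal.ofReal
            ((1 + 1 / (13 * p.m)) * (3 * p.τ₁ ^ 2 * L / 2 * ‖s.z - u‖ ^ 2)))) := by gcongr
    _ = _ := by
      rw [innerPot, pairPot, hpL, mul_comm (5 / 4 * p.τ₁), ENNReal.ofReal_mul (pow_pos hθ0 j).le]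
      ring

/-- Over an epoch the inner potential starts at `pairPot` and gains `5 / 4 * τ₁ * Θ` copies of the
snapshot gap, which is exactly the old outer potential. At the end it dominates `13 / 12` times the
new one. -/
theorem expect_outerPot_le (hP : P.IsComposite μ u) (hμ : 0 < μ) (hμL : μ ≤ L)
    (hs : P.IsSmooth LF BF LG BG) (hc : P.IsCompSmooth L) {p : SoCKParams}
    (hp : p = sockParams L LF BF LG BG μ) (s : OuterState N₂) :
    expect (epoch P p s).law (P.outerPot p u) ≤ ENNReal.ofReal (12 / 13) * P.outerPot p u s := by
  have hm : 0 < p.m := hp ▸ sockParams_m_pos hμ hμL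
  have hM : (1 : ℝ) ≤ p.m := by exact_mod_cast hm
  have hτ : p.τ₁ = 1 / (2 * p.m) := by rw [hp]; rfl
  have hθ : p.θ = 1 + 1 / (12 * p.m) := by rw [hp]; rfl
  have hθ0 : 0 < p.θ := by rw [hθ]; positivity
  have hτ0 : 0 < p.τ₁ := by rw [hτ]; positivity
  set Θ := ∑ i ∈ Finset.range p.m, p.θ ^ i with hΘ
  have hΘ0 : 0 < Θ := Finset.sum_pos (fun i _ => pow_pos hθ0 i) (by simpa using hm.ne')
  -- Bernoulli's inequality.
  have hθm : 13 / 12 ≤ p.θ ^ p.m := by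
    have h := one_add_mul_le_pow (a := 1 / (12 * (p.m : ℝ)))
      (by have : 0 ≤ 1 / (12 * (p.m : ℝ)) := by positivity
          linarith) p.m
    rw [← hθ] at h
    have : (p.m : ℝ) * (1 / (12 * p.m)) = 1 / 12 := by field_simp
    linarith
  have hfinal : ∀ r : InnerState N₂,
      P.outerPot p u { xt := Θ⁻¹ • r.acc, y := r.y, z := r.z }
      ≤ ENNReal.ofReal (12 / 13) * P.innerPot p u p.m r := by
    intro r
    -- There is slack: `5 / 4 * 13 / 12 = 65 / 48 < 19 / 12`.
    have h1 : ENNReal.ofReal (5 / 4 * p.τ₁ * Θ)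
        ≤ ENNReal.ofReal (12 / 13) * (ENNReal.ofReal (19 / 12 * p.τ₁) * ENNReal.ofReal Θ) := by
      rw [← ENNReal.ofReal_mul (by positivity), ← ENNReal.ofReal_mul (by positivity)]
      refine ENNReal.ofReal_le_ofReal ?_
      have : 0 < p.τ₁ * Θ := by positivity
      nlinarith
    have h2 : 1 ≤ ENNReal.ofReal (12 / 13) * ENNReal.ofReal (p.θ ^ p.m) := by
      rw [← ENNReal.ofReal_mul (by positivity), ENNReal.one_le_ofReal]
      linarith
    simp only [outerPot, innerPot, ← hΘ, wgap, hΘ0.ne', if_false]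
    calc _ ≤ ENNReal.ofReal (12 / 13) * (ENNReal.ofReal (19 / 12 * p.τ₁) * ENNReal.ofReal Θ)
          * P.gap (Θ⁻¹ • r.acc) + (ENNReal.ofReal (12 / 13) * ENNReal.ofReal (p.θ ^ p.m))
          * P.pairPot p u r.y r.z := by
          gcongr
          exact (one_mul _).ge.trans (mul_le_mul_left h2 _)
      _ = _ := by ring
  unfold epoch
  rw [takeSnapshot_eq]
  simp only [Alg.expect_law_bind, Alg.expect_law_charged, Alg.pure_eq]
  have hloop := Alg.expect_law_loop_le _ (P.innerPot p u) _
    (fun j s' => hP.expect_innerPot_le hμ hμL hs hc hp s.xt j s') p.m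
    { y := s.y, z := s.z, acc := 0 }
  refine (expect_mono _ hfinal).trans ?_
  rw [expect_const_mul]
  gcongr
  refine hloop.trans (le_of_eq ?_)
  rw [← Finset.sum_mul, ← ENNReal.ofReal_sum_of_nonneg fun i _ => by positivity,
    ← Finset.mul_sum, ← hΘ]
  simp [innerPot, outerPot, wgap, add_comm, ← hΘ]

/-- The factor 16 exceeds the stated 4 because the transfer from the last regularized problem to `H`
doubles the gap. -/
theorem expect_sock_gap_le (hP : P.IsComposite μ u) (hμ : 0 < μ) (hμL : μ ≤ L)
    (hs : P.IsSmooth LF BF LG BG) (hc : P.IsCompSmooth L) (x : Vec N₂) :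
    expect (sock P (sockParams L LF BF LG BG μ) 100 x).law P.gap ≤ P.gap x / 16 := by
  obtain ⟨p, hp⟩ : ∃ p, p = sockParams L LF BF LG BG μ := ⟨_, rfl⟩
  rw [← hp]
  have hm : 0 < p.m := hp ▸ sockParams_m_pos hμ hμL
  have hM : (1 : ℝ) ≤ p.m := by exact_mod_cast hm
  have hL : 0 < L := hμ.trans_le hμL
  have hpL : p.L = L := by rw [hp]; rfl
  have hτ : p.τ₁ = 1 / (2 * p.m) := by rw [hp]; rfl
  have hτM : 2 * p.m * p.τ₁ = 1 := by rw [hτ]; field_simp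
  have hθ : p.θ = 1 + 1 / (12 * p.m) := by rw [hp]; rfl
  have hθ1 : 1 ≤ p.θ := by rw [hθ]; exact le_add_of_nonneg_right (by positivity)
  have hτ0 : 0 < p.τ₁ := by rw [hτ]; positivity
  have hτ1 : 2 * p.τ₁ ≤ 1 := by nlinarith
  set Θ := ∑ i ∈ Finset.range p.m, p.θ ^ i with hΘ
  have hΘ_ge : p.m ≤ Θ := by
    calc (p.m : ℝ) = ∑ i ∈ Finset.range p.m, (1 : ℝ) := by simp
      _ ≤ Θ := Finset.sum_le_sum fun i _ => one_le_pow₀ hθ1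
  have hΘ_le : Θ ≤ p.m * (11 / 4) := by
    have h1 : p.θ ^ p.m ≤ 11 / 4 := by
      have h2 : p.θ ≤ Real.exp (1 / (12 * p.m)) := by
        rw [hθ, add_comm]; exact Real.add_one_le_exp _
      calc p.θ ^ p.m ≤ Real.exp (1 / (12 * p.m)) ^ p.m := by gcongr
        _ = Real.exp (1 / 12) := by
          rw [← Real.exp_nat_mul]; congr 1; field_simp
        _ ≤ Real.exp 1 := Real.exp_le_exp.2 (by norm_num)
        _ ≤ 11 / 4 := by have := Real.exp_one_lt_d9; linarith
    calc Θ ≤ ∑ i ∈ Finset.range p.m, (11 / 4 : ℝ) := Finset.sum_le_sum fun i hi =>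
          (pow_le_pow_right₀ hθ1 (Finset.mem_range.1 hi).le).trans h1
      _ = _ := by simp
  have hloop : ∀ (S : ℕ) (s : OuterState N₂),
      expect (Alg.loop (fun _ => epoch P p) S s).law (P.outerPot p u)
        ≤ ENNReal.ofReal (12 / 13) ^ S * P.outerPot p u s := by
    intro S s
    induction S with
    | zero => simp [Alg.loop, Alg.pure_eq, Alg.expect_law_charged]
    | succ S ih =>
      rw [Alg.loop, Alg.expect_law_bind]
      calc _ ≤ expect _ fun s => ENNReal.ofReal (12 / 13) * P.outerPot p u s :=
            expect_mono _ fun s => hP.expect_outerPot_le hμ hμL hs hc hp s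
        _ ≤ ENNReal.ofReal (12 / 13) * (ENNReal.ofReal (12 / 13) ^ S * P.outerPot p u s) := by
            rw [expect_const_mul]; gcongr
        _ = _ := by ring
  -- `τ₁ * Θ ≥ 1 / 2`, hence `5 / 4 * τ₁ * Θ ≥ 5 / 8`.
  have hlow : ∀ s : OuterState N₂, P.gap s.xt ≤ ENNReal.ofReal (8 / 5) * P.outerPot p u s := by
    intro s
    rw [outerPot, ← hΘ, mul_add, ← mul_assoc]
    refine le_add_right ((one_mul _).ge.trans (mul_le_mul_left ?_ _))
    rw [← ENNReal.ofReal_mul (by norm_num), ENNReal.one_le_ofReal]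
    nlinarith
  -- `6 = 7 / 4 + 1 + 13 / 4`: the snapshot, the `y` and the `z` contributions, the last through `‖x
  -- - u‖² ≤ 2 * D / μ`.
  have hup : P.outerPot p u { xt := x, y := x, z := x } ≤ ENNReal.ofReal 6 * P.gap x := by
    by_cases hx : x ∈ P.dom
    · have hD := hP.norm_sub_sq_le hx
      have hD0 := sub_nonneg.2 (hP.f_add_hr_le hx)
      have hb : 0 ≤ 1 - 7 / 4 * p.τ₁ := by linarith
      simp only [outerPot, pairPot, ← hΘ]
      rw [hP.gap_eq hx, hpL, ← ENNReal.ofReal_mul (by positivity), ← ENNReal.ofReal_mul hb,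
        ← ENNReal.ofReal_mul (by norm_num), ← ENNReal.ofReal_add (by positivity) (by positivity),
        ← ENNReal.ofReal_add (by positivity) (by positivity)]
      refine ENNReal.ofReal_le_ofReal ?_
      set D := P.f x + P.hr x - (P.f u + P.hr u)
      have h1 : 5 / 4 * p.τ₁ * Θ * D ≤ 7 / 4 * D := by
        gcongr
        calc 5 / 4 * p.τ₁ * Θ ≤ 5 / 4 * p.τ₁ * (p.m * (11 / 4)) := by gcongr
          _ ≤ 7 / 4 := by nlinarith
      have h2 : (1 - 7 / 4 * p.τ₁) * D ≤ 1 * D := by gcongr; linarith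
      have h3 : 3 * p.τ₁ ^ 2 * L / 2 * ‖x - u‖ ^ 2 ≤ 3 * D := by
        have h4 : p.τ₁ ^ 2 * L ≤ μ := by
          have : p.τ₁ ^ 2 * L ≤ p.τ₁ ^ 2 * (4 * (p.m : ℝ) ^ 2 * μ) := by
            gcongr; exact hp ▸ le_sockParams_m_sq hμ hμL
          have h5 : p.τ₁ ^ 2 * (4 * (p.m : ℝ) ^ 2 * μ) = (2 * p.m * p.τ₁) ^ 2 * μ := by ring
          rw [h5, hτM] at this
          linarith
        have := mul_le_mul_of_nonneg_right h4 (sq_nonneg ‖x - u‖)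
        linarith
      have h6 : (1 + 1 / (13 * (p.m : ℝ))) * (3 * p.τ₁ ^ 2 * L / 2 * ‖x - u‖ ^ 2)
          ≤ 13 / 12 * (3 * D) := by
        gcongr
        have : 1 / (13 * (p.m : ℝ)) ≤ 1 / (13 * 1) := by gcongr
        linarith
      linarith
    · rw [hP.gap_eq_top hx, ENNReal.mul_top (by norm_num)]
      exact le_top
  unfold sock
  simp only [Alg.expect_law_bind, Alg.pure_eq, Alg.expect_law_charged]
  calc _ ≤ expect _ fun s => ENNReal.ofReal (8 / 5) * P.outerPot p u s := expect_mono _ hlow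
    _ ≤ ENNReal.ofReal (8 / 5) * (ENNReal.ofReal (12 / 13) ^ 100 * (ENNReal.ofReal 6 * P.gap x)) := by
      rw [expect_const_mul]
      gcongr
      exact (hloop _ _).trans (by gcongr)
    _ = ENNReal.ofReal (8 / 5 * (12 / 13) ^ 100 * 6) * P.gap x := by
      rw [ENNReal.ofReal_mul (by positivity), ENNReal.ofReal_mul (by positivity),
        ENNReal.ofReal_pow (by positivity)]
      ring
    _ ≤ ENNReal.ofReal (1 / 16) * P.gap x := by gcongr; norm_num
    _ = P.gap x / 16 := by
      rw [ENNReal.ofReal_div_of_pos (by norm_num), ENNReal.ofReal_one, ENNReal.ofReal_ofNat,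
        one_div, mul_comm, ENNReal.div_eq_inv_mul, mul_comm]

end IsComposite

end COP

/-! ### The regularized problems -/

namespace COP

variable {n₁ n₂ N₁ N₂ : ℕ} {P : COP n₁ n₂ N₁ N₂} {L LF BF LG BG μ : ℝ} {u c : Vec N₂}

theorem IsSmooth.regularize (hs : P.IsSmooth LF BF LG BG) (c : Vec N₂) (μ : ℝ) :
    (P.regularize c μ).IsSmooth LF BF LG BG :=
  ⟨hs.LF_nonneg, hs.LG_nonneg, hs.diff_F, hs.diff_G, hs.lip_F, hs.bdd_F, hs.lip_G, hs.bdd_G⟩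

theorem IsCompSmooth.regularize (hc : P.IsCompSmooth L) (c : Vec N₂) (μ : ℝ) :
    (P.regularize c μ).IsCompSmooth L := hc

theorem IsConvex.isComposite (h : P.IsConvex) (hu : ∀ x, P.H u ≤ P.H x) : P.IsComposite 0 u where
  convex_f := h.convex_f
  h_ne_bot := h.h_ne_bot
  h_closed := h.h_closed
  strongConvex_h := by
    have key : ∀ x ∈ P.dom, ∀ y ∈ P.dom, ∀ a b : ℝ, 0 ≤ a → 0 ≤ b → a + b = 1 →
        P.h (a • x + b • y) ≤ ((a * P.hr x + b * P.hr y : ℝ) : EReal) := by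
      intro x hx y hy a b ha hb hab
      have hx' : (x, P.hr x) ∈ {p : Vec N₂ × ℝ | P.h p.1 ≤ (p.2 : EReal)} :=
        (EReal.coe_toReal hx (h.h_ne_bot x)).ge
      have hy' : (y, P.hr y) ∈ {p : Vec N₂ × ℝ | P.h p.1 ≤ (p.2 : EReal)} :=
        (EReal.coe_toReal hy (h.h_ne_bot y)).ge
      exact h.h_convex hx' hy' ha hb hab
    rw [strongConvexOn_zero]
    refine ⟨fun x hx y hy a b ha hb hab => ?_, fun x hx y hy a b ha hb hab => ?_⟩
    · exact ne_top_of_le_ne_top (EReal.coe_ne_top _) (key x hx y hy a b ha hb hab)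
    · have := EReal.toReal_le_toReal (key x hx y hy a b ha hb hab) (h.h_ne_bot _)
        (EReal.coe_ne_top _)
      rwa [EReal.toReal_coe] at this
  mem_dom := by
    obtain ⟨x, hx⟩ := h.h_proper
    intro hu'
    have h1 := hu x
    rw [H, H, hu', EReal.coe_add_top, top_le_iff] at h1
    exact EReal.add_ne_top (EReal.coe_ne_top _) hx h1
  isMin := hu

theorem regularize_h_of_mem (hP : P.IsComposite 0 u) (c : Vec N₂) (μ : ℝ) {x : Vec N₂}
    (hx : x ∈ P.dom) :
    (P.regularize c μ).h x = ((P.hr x + μ / 2 * ‖x - c‖ ^ 2 : ℝ) : EReal) := by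
  rw [EReal.coe_add, ← hP.h_eq hx]
  rfl

theorem dom_regularize (hP : P.IsComposite 0 u) (c : Vec N₂) (μ : ℝ) :
    (P.regularize c μ).dom = P.dom := by
  ext x
  by_cases hx : x ∈ P.dom
  · refine iff_of_true ?_ hx
    change (P.regularize c μ).h x ≠ ⊤
    rw [regularize_h_of_mem hP c μ hx]
    exact EReal.coe_ne_top _
  · refine iff_of_false (not_not.2 ?_) hx
    have hx' : P.h x = ⊤ := not_not.1 hx
    change P.h x + _ = ⊤
    rw [hx', EReal.top_add_coe]

theorem hr_regularize (hP : P.IsComposite 0 u) (c : Vec N₂) (μ : ℝ) {x : Vec N₂} (hx : x ∈ P.dom) :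
    (P.regularize c μ).hr x = P.hr x + μ / 2 * ‖x - c‖ ^ 2 := by
  rw [hr, regularize_h_of_mem hP c μ hx, EReal.toReal_coe]

/-- The minimum of `H` bounds the regularized objective below by a quadratic, which gives
coercivity. -/
theorem IsComposite.exists_regularize (hP : P.IsComposite 0 u) (hs : P.IsSmooth LF BF LG BG)
    (c : Vec N₂) (hμ : 0 < μ) : ∃ v, (P.regularize c μ).IsComposite μ v := by
  have hdom := dom_regularize hP c μ
  have hbot : ∀ x, (P.regularize c μ).h x ≠ ⊥ := by
    intro x
    by_cases hx : x ∈ P.dom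
    · rw [regularize_h_of_mem hP c μ hx]
      exact EReal.coe_ne_bot _
    · have hx' : P.h x = ⊤ := not_not.1 hx
      change P.h x + _ ≠ ⊥
      rw [hx', EReal.top_add_coe]
      exact top_ne_bot
  have hlsc : LowerSemicontinuous (P.regularize c μ).h := by
    refine LowerSemicontinuous.add' hP.h_closed ?_ fun x => ?_
    · refine Continuous.lowerSemicontinuous ?_
      exact continuous_coe_real_ereal.comp (by fun_prop)
    · exact EReal.continuousAt_add (.inr (EReal.coe_ne_bot _)) (.inr (EReal.coe_ne_top _))
  have hHlsc : LowerSemicontinuous (P.regularize c μ).H := by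
    refine LowerSemicontinuous.add' ?_ hlsc fun x => ?_
    · refine Continuous.lowerSemicontinuous ?_
      have hf : Differentiable ℝ P.f := fun x => (hs.hasGradientAt_f x).differentiableAt
      exact continuous_coe_real_ereal.comp hf.continuous
    · exact EReal.continuousAt_add (.inl (EReal.coe_ne_top _)) (.inl (EReal.coe_ne_bot _))
  have hval : ∀ x ∈ P.dom, (P.regularize c μ).H x
      = ((P.f x + (P.hr x + μ / 2 * ‖x - c‖ ^ 2) : ℝ) : EReal) := by
    intro x hx
    rw [EReal.coe_add, ← regularize_h_of_mem hP c μ hx]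
    rfl
  have htop : ∀ x, x ∉ P.dom → (P.regularize c μ).H x = ⊤ := by
    intro x hx
    have hx' : (P.regularize c μ).h x = ⊤ := by
      rw [← hdom] at hx
      exact not_not.1 hx
    rw [H, hx', EReal.coe_add_top]
  obtain ⟨v, hv⟩ := exists_forall_le_of_quadratic_le hHlsc (x₀ := u) (p := c)
    (by rw [hval u hP.mem_dom]; exact EReal.coe_ne_top _) (half_pos hμ)
    (b := -(P.f u + P.hr u)) fun x => by
      by_cases hx : x ∈ P.dom
      · rw [hval x hx, EReal.coe_le_coe_iff]
        have := hP.f_add_hr_le hx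
        linarith
      · rw [htop x hx]; exact le_top
  refine ⟨v, hP.convex_f, hbot, hlsc, ?_, ?_, hv⟩
  · rw [hdom]
    have h1 := hP.strongConvex_h.add_inner_add_sq 0 c μ
    rw [zero_add, strongConvexOn_iff_convex] at h1
    rw [strongConvexOn_iff_convex]
    refine h1.congr fun x hx => ?_
    simp only [hr_regularize hP c μ hx, inner_zero_left]
    ring
  · rw [hdom]
    by_contra h
    have := hv u
    rw [htop v h, hval u hP.mem_dom] at this
    exact EReal.coe_ne_top _ (top_le_iff.1 this)

/-! ### Comparison of the gaps -/

theorem gap_regularize_self_le (hP : P.IsComposite 0 u) {v : Vec N₂}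
    (hv : (P.regularize c μ).IsComposite μ v) (hμ : 0 ≤ μ) {D : ℝ}
    (hc : P.H c - P.H u ≤ (D : EReal)) : (P.regularize c μ).gap c ≤ ENNReal.ofReal D := by
  have hcd : c ∈ P.dom := by
    intro h
    rw [hP.H_eq hP.mem_dom, H, h, EReal.coe_add_top, EReal.top_sub_coe] at hc
    exact EReal.coe_ne_top _ (top_le_iff.1 hc)
  have hdom := dom_regularize hP c μ
  have hvd : v ∈ P.dom := hdom ▸ hv.mem_dom
  rw [hP.H_eq hP.mem_dom, hP.H_eq hcd, ← EReal.coe_sub, EReal.coe_le_coe_iff] at hc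
  rw [hv.gap_eq (hdom ▸ hcd), hr_regularize hP c μ hcd, hr_regularize hP c μ hvd]
  refine ENNReal.ofReal_le_ofReal ?_
  change P.f c + _ - (P.f v + _) ≤ D
  have := hP.f_add_hr_le hvd
  have : 0 ≤ μ / 2 * ‖v - c‖ ^ 2 := by positivity
  simp only [sub_self, norm_zero]
  linarith

/-- The minimizer `w` of the weaker regularization is no farther from `c` than `u` is: otherwise `u`
would beat it in both terms. Restoring the removed penalty at `w` thus costs at most `μ / 2 * D`. -/
theorem gap_regularize_half_le (hP : P.IsComposite 0 u) {v w : Vec N₂} (hμ : 0 < μ)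
    (hv : (P.regularize c (2 * μ)).IsComposite (2 * μ) v)
    (hw : (P.regularize c μ).IsComposite μ w) {D : ℝ} (hD : ‖c - u‖ ^ 2 ≤ D) (x : Vec N₂) :
    (P.regularize c μ).gap x
      ≤ (P.regularize c (2 * μ)).gap x + ENNReal.ofReal (μ / 2 * D) := by
  have hdom := dom_regularize hP c μ
  have hdom' := dom_regularize hP c (2 * μ)
  have hvd : v ∈ P.dom := hdom' ▸ hv.mem_dom
  have hwd : w ∈ P.dom := hdom ▸ hw.mem_dom
  have hD0 : 0 ≤ D := (sq_nonneg _).trans hD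
  by_cases hx : x ∈ P.dom
  swap
  · rw [hv.gap_eq_top (hdom' ▸ hx)]
    simp
  have h1 := hv.f_add_hr_le (hdom' ▸ hwd)
  have h2 := hw.f_add_hr_le (hdom ▸ hP.mem_dom)
  have h3 := hP.f_add_hr_le hwd
  have h4 := hv.f_add_hr_le (hdom' ▸ hx)
  rw [hw.gap_eq (hdom ▸ hx), hv.gap_eq (hdom' ▸ hx), ← ENNReal.ofReal_add (sub_nonneg.2 h4)
    (by positivity)]
  refine ENNReal.ofReal_le_ofReal ?_
  rw [hr_regularize hP c _ hwd, hr_regularize hP c _ hvd] at h1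
  rw [hr_regularize hP c _ hwd, hr_regularize hP c _ hP.mem_dom] at h2
  rw [hr_regularize hP c _ hwd, hr_regularize hP c _ hvd, hr_regularize hP c _ hx,
    hr_regularize hP c _ hx]
  change P.f v + _ ≤ P.f w + _ at h1
  change P.f w + _ ≤ P.f u + _ at h2
  change P.f x + _ - (P.f w + _) ≤ P.f x + _ - (P.f v + _) + _
  rw [norm_sub_rev u c] at h2
  have h5 : μ / 2 * ‖c - u‖ ^ 2 ≤ μ / 2 * D := by gcongr
  have h6 : 0 ≤ μ / 2 * ‖x - c‖ ^ 2 := by positivity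
  linarith

/-- The constant `1 / 3` matters. Dropping the penalty directly would cost `μ / 2 * D`, which in the
last stage uses up the whole target. Testing the regularized problem at the midpoint of `x` and `u`
costs less, at the price of doubling the regularized gap. -/
theorem gap_le_gap_regularize (hP : P.IsComposite 0 u) {v : Vec N₂} (hμ : 0 < μ)
    (hv : (P.regularize c μ).IsComposite μ v) {D : ℝ} (hD : ‖c - u‖ ^ 2 ≤ D) (x : Vec N₂) :
    P.gap x ≤ 2 * (P.regularize c μ).gap x + ENNReal.ofReal (μ / 3 * D) := by
  have hdom := dom_regularize hP c μ
  have hvd : v ∈ P.dom := hdom ▸ hv.mem_dom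
  have hD0 : 0 ≤ D := (sq_nonneg _).trans hD
  by_cases hx : x ∈ P.dom
  swap
  · rw [hv.gap_eq_top (hdom ▸ hx)]
    simp
  have hhalf : (0 : ℝ) ≤ 1 / 2 := by norm_num
  have hsum : (1 / 2 : ℝ) + 1 / 2 = 1 := by norm_num
  have hwd := hP.strongConvex_h.1 hx hP.mem_dom hhalf hhalf hsum
  have h1 := (hP.convexOn_hr le_rfl).2 hx hP.mem_dom hhalf hhalf hsum
  have h2 := hP.convex_f.2 (Set.mem_univ x) (Set.mem_univ u) hhalf hhalf hsum
  set w := (1 / 2 : ℝ) • x + (1 / 2 : ℝ) • u with hw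
  have h3 := hv.f_add_hr_le (hdom ▸ hwd)
  have h4 := hv.f_add_hr_le (hdom ▸ hx)
  rw [hP.gap_eq hx, hv.gap_eq (hdom ▸ hx), ← ENNReal.ofReal_ofNat, ← ENNReal.ofReal_mul
    (by norm_num), ← ENNReal.ofReal_add (mul_nonneg (by norm_num) (sub_nonneg.2 h4))
    (by positivity)]
  refine ENNReal.ofReal_le_ofReal ?_
  rw [hr_regularize hP c _ hwd, hr_regularize hP c _ hvd] at h3
  rw [hr_regularize hP c _ hvd, hr_regularize hP c _ hx]
  change P.f v + _ ≤ P.f w + _ at h3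
  change _ ≤ 2 * (P.f x + _ - (P.f v + _)) + _
  -- With `a = ‖x - c‖` and `b = ‖c - u‖`, `a² + b² / 3 - (a + b)² / 4 = (3 * a - b)² / 12`.
  have h5 : ‖w - c‖ ^ 2 ≤ ‖x - c‖ ^ 2 + ‖c - u‖ ^ 2 / 3 := by
    have h6 : w - c = (1 / 2 : ℝ) • ((x - c) - (c - u)) := by rw [hw]; module
    rw [h6, norm_smul, mul_pow, norm_sub_sq_real]
    have h7 := abs_real_inner_le_norm (x - c) (c - u)
    have h8 := neg_abs_le (inner ℝ (x - c) (c - u))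
    norm_num
    nlinarith [sq_nonneg (3 * ‖x - c‖ - ‖c - u‖)]
  have h9 : μ * ‖w - c‖ ^ 2 ≤ μ * (‖x - c‖ ^ 2 + ‖c - u‖ ^ 2 / 3) := by gcongr
  have h10 : μ / 3 * ‖c - u‖ ^ 2 ≤ μ / 3 * D := by gcongr
  simp only [smul_eq_mul] at h1 h2
  linarith

end COP

/-! ### The guarantee of NoCK -/

section Nock

variable {n₁ n₂ N₁ N₂ : ℕ} [NeZero n₁] [NeZero n₂] {P : COP n₁ n₂ N₁ N₂}
  {L LF BF LG BG : ℝ} {x₀ u : Vec N₂}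

/-- A stage multiplies the gap by `1 / 16` and the change of regularization adds `1 / 4` of `DH / 2
^ t`; together this is below `1 / 2`. -/
theorem expect_nock_gap_regularize_le (hP : P.IsComposite 0 u) (hs : P.IsSmooth LF BF LG BG)
    (hc : P.IsCompSmooth L) {DH Dx : ℝ} (hDH : 0 < DH) (hDx : 0 < Dx)
    (hx₀ : P.H x₀ - P.H u ≤ (DH : EReal)) (hxu : ‖x₀ - u‖ ^ 2 ≤ Dx) (hL : DH / Dx ≤ L) (t : ℕ) :
    expect (nock P L LF BF LG BG 100 (DH / Dx) t x₀).law
      (P.regularize x₀ (DH / Dx / 2 ^ t)).gap ≤ ENNReal.ofReal (DH / 2 ^ t) := by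
  have hμ : ∀ t : ℕ, 0 < DH / Dx / 2 ^ t := fun t => by positivity
  have hμL : ∀ t : ℕ, DH / Dx / 2 ^ t ≤ L := fun t =>
    (div_le_self (by positivity) (one_le_pow₀ one_le_two)).trans hL
  induction t with
  | zero =>
    obtain ⟨v, hv⟩ := hP.exists_regularize hs x₀ (hμ 0)
    simp only [nock, Alg.loop, Alg.pure_eq, Alg.expect_law_charged]
    simpa using COP.gap_regularize_self_le hP hv (hμ 0).le hx₀
  | succ t ih =>
    obtain ⟨v, hv⟩ := hP.exists_regularize hs x₀ (hμ t)
    obtain ⟨w, hw⟩ := hP.exists_regularize hs x₀ (hμ (t + 1))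
    have htwo : DH / Dx / 2 ^ t = 2 * (DH / Dx / 2 ^ (t + 1)) := by rw [pow_succ]; field_simp
    have hnext : ∀ x, (P.regularize x₀ (DH / Dx / 2 ^ (t + 1))).gap x
        ≤ (P.regularize x₀ (DH / Dx / 2 ^ t)).gap x + ENNReal.ofReal (DH / 2 ^ t / 4) := by
      intro x
      have hv' := hv
      rw [htwo] at hv' ⊢
      convert COP.gap_regularize_half_le hP (hμ (t + 1)) hv' hw hxu x using 3
      rw [pow_succ]
      field_simp
      norm_num
    rw [nock, Alg.loop, Alg.expect_law_bind]
    calc _ ≤ expect (nock P L LF BF LG BG 100 (DH / Dx) t x₀).law fun x =>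
          (16 : ℝ≥0∞)⁻¹ * (P.regularize x₀ (DH / Dx / 2 ^ t)).gap x
            + ENNReal.ofReal (DH / 2 ^ t / 4) := by
          refine expect_mono _ fun x => (expect_mono _ hnext).trans ?_
          rw [expect_add, expect_const, ← ENNReal.div_eq_inv_mul]
          gcongr
          exact hv.expect_sock_gap_le (hμ t) (hμL t) (hs.regularize _ _) (hc.regularize _ _) x
      _ ≤ (16 : ℝ≥0∞)⁻¹ * ENNReal.ofReal (DH / 2 ^ t) + ENNReal.ofReal (DH / 2 ^ t / 4) := by
          rw [expect_add, expect_const, expect_const_mul]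
          gcongr
      _ = ENNReal.ofReal (16⁻¹ * (DH / 2 ^ t) + DH / 2 ^ t / 4) := by
          rw [ENNReal.ofReal_add (by positivity) (by positivity),
            ENNReal.ofReal_mul (by positivity), ENNReal.ofReal_inv_of_pos (by norm_num),
            ENNReal.ofReal_ofNat]
      _ ≤ _ := by
          refine ENNReal.ofReal_le_ofReal ?_
          have h1 : DH / 2 ^ (t + 1) = DH / 2 ^ t / 2 := by rw [pow_succ]; field_simp
          have h2 : 0 < DH / 2 ^ t := by positivity
          rw [h1]
          linarith

/-- The last stage is treated apart, going straight to `H`: `2 / 16 + 1 / 3 < 1 / 2`. -/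
theorem expect_nock_gap_le (hP : P.IsComposite 0 u) (hs : P.IsSmooth LF BF LG BG)
    (hc : P.IsCompSmooth L) {DH Dx : ℝ} (hDH : 0 < DH) (hDx : 0 < Dx)
    (hx₀ : P.H x₀ - P.H u ≤ (DH : EReal)) (hxu : ‖x₀ - u‖ ^ 2 ≤ Dx) (hL : DH / Dx ≤ L) (T : ℕ) :
    expect (nock P L LF BF LG BG 100 (DH / Dx) T x₀).law P.gap ≤ ENNReal.ofReal (DH / 2 ^ T) := by
  have hμ : ∀ t : ℕ, 0 < DH / Dx / 2 ^ t := fun t => by positivity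
  have hμL : ∀ t : ℕ, DH / Dx / 2 ^ t ≤ L := fun t =>
    (div_le_self (by positivity) (one_le_pow₀ one_le_two)).trans hL
  cases T with
  | zero =>
    simp only [nock, Alg.loop, Alg.pure_eq, Alg.expect_law_charged]
    rw [COP.gap, hP.iInf_H, pow_zero, div_one]
    refine (EReal.toENNReal_le_toENNReal hx₀).trans (le_of_eq ?_)
    rw [EReal.toENNReal_of_ne_top (EReal.coe_ne_top DH), EReal.toReal_coe]
  | succ t =>
    obtain ⟨v, hv⟩ := hP.exists_regularize hs x₀ (hμ t)
    have hstage := expect_nock_gap_regularize_le hP hs hc hDH hDx hx₀ hxu hL t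
    have hD : DH / Dx / 2 ^ t / 3 * Dx = DH / 2 ^ t / 3 := by field_simp
    rw [nock, Alg.loop, Alg.expect_law_bind]
    calc _ ≤ expect (nock P L LF BF LG BG 100 (DH / Dx) t x₀).law fun x =>
          2 * ((16 : ℝ≥0∞)⁻¹ * (P.regularize x₀ (DH / Dx / 2 ^ t)).gap x)
            + ENNReal.ofReal (DH / 2 ^ t / 3) := by
          refine expect_mono _ fun x =>
            (expect_mono _ (COP.gap_le_gap_regularize hP (hμ t) hv hxu)).trans ?_
          rw [expect_add, expect_const, expect_const_mul, ← ENNReal.div_eq_inv_mul, hD]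
          gcongr
          exact hv.expect_sock_gap_le (hμ t) (hμL t) (hs.regularize _ _) (hc.regularize _ _) x
      _ ≤ 2 * ((16 : ℝ≥0∞)⁻¹ * ENNReal.ofReal (DH / 2 ^ t)) + ENNReal.ofReal (DH / 2 ^ t / 3) := by
          rw [expect_add, expect_const, expect_const_mul, expect_const_mul]
          gcongr
      _ = ENNReal.ofReal (2 * (16⁻¹ * (DH / 2 ^ t)) + DH / 2 ^ t / 3) := by
          rw [ENNReal.ofReal_add (by positivity) (by positivity),
            ENNReal.ofReal_mul (by positivity), ENNReal.ofReal_mul (by positivity),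
            ENNReal.ofReal_inv_of_pos (by norm_num), ENNReal.ofReal_ofNat, ENNReal.ofReal_ofNat]
      _ ≤ _ := by
          refine ENNReal.ofReal_le_ofReal ?_
          have h1 : DH / 2 ^ (t + 1) = DH / 2 ^ t / 2 := by rw [pow_succ]; field_simp
          have h2 : 0 < DH / 2 ^ t := by positivity
          rw [h1]
          linarith

/-! ### The oracle complexity of NoCK -/

theorem rpow_five_halves {x : ℝ} (hx : 0 ≤ x) : x ^ (5 / 2 : ℝ) = x ^ 2 * √x := by
  rw [Real.sqrt_eq_rpow, ← Real.rpow_natCast, ← Real.rpow_add_of_nonneg hx (by norm_num)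
    (by norm_num)]
  norm_num

/-- Since `X / μ ^ 2 ≥ 1`, the roundings are absorbed: `10808 = 2 * (2160 + 2160 + 1080) + 8`. -/
theorem sockParams_cost_le {μ : ℝ} (hμ : 0 < μ) (hμL : μ ≤ L) :
    ((sockParams L LF BF LG BG μ).m * (2 * (sockParams L LF BF LG BG μ).A
      + 2 * (sockParams L LF BF LG BG μ).B + 2 * (sockParams L LF BF LG BG μ).C + 2) : ℝ)
      ≤ 10808 * (√L * max (max (BG ^ 4 * LF ^ 2) (BF ^ 2 * LG ^ 2)) (L ^ 2)
        * (1 / μ) ^ (5 / 2 : ℝ)) := by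
  have hL : 0 < L := hμ.trans_le hμL
  set X := max (max (BG ^ 4 * LF ^ 2) (BF ^ 2 * LG ^ 2)) (L ^ 2) with hX
  have hXL : L ^ 2 ≤ X := le_max_right _ _
  have hXA : BG ^ 4 * LF ^ 2 ≤ X := (le_max_left _ _).trans (le_max_left _ _)
  have hXB : BF ^ 2 * LG ^ 2 ≤ X := (le_max_right _ _).trans (le_max_left _ _)
  have hX1 : 1 ≤ X / μ ^ 2 := by
    rw [one_le_div (by positivity)]
    exact (by gcongr : μ ^ 2 ≤ L ^ 2).trans hXL
  have hmax : ∀ v : ℝ, 0 ≤ v → ((max 1 ⌈v⌉₊ : ℕ) : ℝ) ≤ v + 1 := by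
    intro v hv
    rw [Nat.cast_max, Nat.cast_one]
    exact max_le (by linarith) (Nat.ceil_lt_add_one hv).le
  have hBG : 0 ≤ BG ^ 4 := by positivity
  have hA : ((sockParams L LF BF LG BG μ).A : ℝ) ≤ 2160 * (X / μ ^ 2) + 1 := by
    refine (hmax _ (by positivity)).trans ?_
    rw [mul_assoc, mul_div_assoc]
    gcongr
  have hB : ((sockParams L LF BF LG BG μ).B : ℝ) ≤ 2160 * (X / μ ^ 2) + 1 := by
    refine (hmax _ (by positivity)).trans ?_
    rw [mul_assoc, mul_div_assoc]
    gcongr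
  have hC : ((sockParams L LF BF LG BG μ).C : ℝ) ≤ 1080 * (X / μ ^ 2) + 1 := by
    refine (hmax _ (by positivity)).trans ?_
    rw [mul_div_assoc]
    gcongr
  have hm : ((sockParams L LF BF LG BG μ).m : ℝ) ≤ √(L * (1 / μ)) := by
    refine Real.le_sqrt_of_sq_le ?_
    rw [mul_one_div, le_div_iff₀ hμ]
    exact sockParams_m_sq_le hμ hμL
  calc _ ≤ √(L * (1 / μ)) * (10808 * (X / μ ^ 2)) := by
        gcongr
        linarith
    _ = _ := by
        rw [rpow_five_halves (by positivity), Real.sqrt_mul hL.le]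
        field_simp

theorem costLe_nock (S : ℕ) (μ₀ : ℝ) (T : ℕ) (x₀ : Vec N₂) :
    (nock P L LF BF LG BG S μ₀ T x₀).CostLe (∑ t ∈ Finset.range T,
      S * (2 * n₂ + n₁ + (sockParams L LF BF LG BG (μ₀ / 2 ^ t)).m
        * (2 * (sockParams L LF BF LG BG (μ₀ / 2 ^ t)).A
          + 2 * (sockParams L LF BF LG BG (μ₀ / 2 ^ t)).B
          + 2 * (sockParams L LF BF LG BG (μ₀ / 2 ^ t)).C + 2))) := by
  have h := fun (t : ℕ) (x : Vec N₂) => costLe_sock (P.regularize x₀ (μ₀ / 2 ^ t))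
    (sockParams L LF BF LG BG (μ₀ / 2 ^ t)) S x
  exact Alg.CostLe.loop h T x₀

/-- Each term is at least twice the previous one, so the sum stays below the next term. -/
theorem sum_rpow_five_halves_le {μ₀ : ℝ} (hμ₀ : 0 < μ₀) (T : ℕ) :
    ∑ t ∈ Finset.range T, (1 / (μ₀ / 2 ^ t)) ^ (5 / 2 : ℝ) ≤ (1 / (μ₀ / 2 ^ T)) ^ (5 / 2 : ℝ) := by
  induction T with
  | zero => simp; positivity
  | succ T ih =>
    rw [Finset.sum_range_succ]
    have h1 : 1 / (μ₀ / 2 ^ (T + 1)) = 2 * (1 / (μ₀ / 2 ^ T)) := by rw [pow_succ]; field_simp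
    have h2 : (2 : ℝ) ≤ 2 ^ (5 / 2 : ℝ) := by
      conv_lhs => rw [← Real.rpow_one 2]
      exact Real.rpow_le_rpow_of_exponent_le one_le_two (by norm_num)
    rw [h1, Real.mul_rpow (by norm_num) (by positivity)]
    have h3 : 0 ≤ (1 / (μ₀ / 2 ^ T)) ^ (5 / 2 : ℝ) := by positivity
    nlinarith

theorem cost_nock_le {DH Dx ε : ℝ} (hDH : 0 < DH) (hDx : 0 < Dx) (hε : 0 < ε)
    (hL : DH / Dx ≤ L) (hεDH : 2 * ε ≤ DH) (x₀ : Vec N₂) (r : Vec N₂ × ℕ)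
    (hr : r ∈ (nock P L LF BF LG BG 100 (DH / Dx) ⌈Real.logb 2 (DH / ε)⌉₊ x₀).run.support) :
    (r.2 : ℝ) ≤ 10 ^ 7 * ((n₁ + n₂) * Real.log (DH / ε)
      + Dx ^ (5 / 2 : ℝ) * √L * max (max (BG ^ 4 * LF ^ 2) (BF ^ 2 * LG ^ 2)) (L ^ 2)
        / ε ^ (5 / 2 : ℝ)) := by
  set T := ⌈Real.logb 2 (DH / ε)⌉₊ with hT
  set X := max (max (BG ^ 4 * LF ^ 2) (BF ^ 2 * LG ^ 2)) (L ^ 2) with hX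
  have hX0 : 0 ≤ X := (sq_nonneg L).trans (le_max_right _ _)
  have hμ₀ : 0 < DH / Dx := by positivity
  have hq : 2 ≤ DH / ε := by rw [le_div_iff₀ hε]; exact hεDH
  have hlog1 : 1 ≤ Real.logb 2 (DH / ε) := by
    rw [Real.le_logb_iff_rpow_le one_lt_two (by positivity), Real.rpow_one]
    exact hq
  -- Rounding `T` up at most doubles `2 ^ T`, hence the factor `2 ^ (5 / 2) ≤ 8` below.
  have hTlt : (T : ℝ) < Real.logb 2 (DH / ε) + 1 := Nat.ceil_lt_add_one (by linarith)
  have hlog0 : 0 ≤ Real.log (DH / ε) := Real.log_nonneg (by linarith)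
  have hTlog : (T : ℝ) ≤ 4 * Real.log (DH / ε) := by
    have h2 : Real.logb 2 (DH / ε) ≤ 2 * Real.log (DH / ε) := by
      rw [Real.logb, div_le_iff₀ (Real.log_pos one_lt_two)]
      have := Real.log_two_gt_d9
      nlinarith
    linarith
  have hpow : (1 / (DH / Dx / 2 ^ T)) ^ (5 / 2 : ℝ)
      ≤ 8 * (Dx ^ (5 / 2 : ℝ) / ε ^ (5 / 2 : ℝ)) := by
    have h1 : (2 : ℝ) ^ T ≤ 2 * (DH / ε) := by
      have h3 : ((2 : ℝ) ^ (T : ℝ)) ≤ 2 ^ (Real.logb 2 (DH / ε) + 1) :=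
        Real.rpow_le_rpow_of_exponent_le one_le_two hTlt.le
      rw [Real.rpow_natCast, Real.rpow_add_one (by norm_num),
        Real.rpow_logb (by norm_num) (by norm_num) (by positivity)] at h3
      linarith
    have h2 : 1 / (DH / Dx / 2 ^ T) ≤ 2 * (Dx / ε) := by
      calc 1 / (DH / Dx / 2 ^ T) = 2 ^ T * (Dx / DH) := by field_simp
        _ ≤ 2 * (DH / ε) * (Dx / DH) := by gcongr
        _ = _ := by field_simp
    have h8 : (2 : ℝ) ^ (5 / 2 : ℝ) ≤ 8 := by
      calc (2 : ℝ) ^ (5 / 2 : ℝ) ≤ 2 ^ (3 : ℝ) :=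
            Real.rpow_le_rpow_of_exponent_le one_le_two (by norm_num)
        _ = 8 := by norm_num
    calc _ ≤ (2 * (Dx / ε)) ^ (5 / 2 : ℝ) := by gcongr
      _ = 2 ^ (5 / 2 : ℝ) * (Dx ^ (5 / 2 : ℝ) / ε ^ (5 / 2 : ℝ)) := by
        rw [Real.mul_rpow (by norm_num) (by positivity), Real.div_rpow hDx.le hε.le]
      _ ≤ _ := by gcongr
  have hstage : ∀ t : ℕ, ((100 * (2 * n₂ + n₁ + (sockParams L LF BF LG BG (DH / Dx / 2 ^ t)).m
        * (2 * (sockParams L LF BF LG BG (DH / Dx / 2 ^ t)).A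
          + 2 * (sockParams L LF BF LG BG (DH / Dx / 2 ^ t)).B
          + 2 * (sockParams L LF BF LG BG (DH / Dx / 2 ^ t)).C + 2)) : ℕ) : ℝ)
      ≤ 200 * (n₁ + n₂) + 1080800 * (√L * X) * (1 / (DH / Dx / 2 ^ t)) ^ (5 / 2 : ℝ) := by
    intro t
    have h1 := sockParams_cost_le (LF := LF) (BF := BF) (LG := LG) (BG := BG)
      (by positivity : 0 < DH / Dx / 2 ^ t)
      ((div_le_self hμ₀.le (one_le_pow₀ one_le_two)).trans hL)
    rw [← hX] at h1
    push_cast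
    have : (0 : ℝ) ≤ n₁ := Nat.cast_nonneg _
    linarith
  have hcost : (r.2 : ℝ) ≤ _ := Nat.cast_le.2 (costLe_nock 100 (DH / Dx) T x₀ r hr)
  rw [Nat.cast_sum] at hcost
  have hsum := sum_rpow_five_halves_le hμ₀ T
  calc (r.2 : ℝ) ≤ _ := hcost
    _ ≤ ∑ t ∈ Finset.range T, (200 * ((n₁ : ℝ) + n₂)
        + 1080800 * (√L * X) * (1 / (DH / Dx / 2 ^ t)) ^ (5 / 2 : ℝ)) :=
      Finset.sum_le_sum fun t _ => hstage t
    _ = T * (200 * ((n₁ : ℝ) + n₂)) + 1080800 * (√L * X)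
        * ∑ t ∈ Finset.range T, (1 / (DH / Dx / 2 ^ t)) ^ (5 / 2 : ℝ) := by
      rw [Finset.sum_add_distrib, Finset.mul_sum]
      simp
    _ ≤ 4 * Real.log (DH / ε) * (200 * ((n₁ : ℝ) + n₂)) + 1080800 * (√L * X)
        * (8 * (Dx ^ (5 / 2 : ℝ) / ε ^ (5 / 2 : ℝ))) := by
      gcongr
      exact hsum.trans hpow
    _ = 800 * (((n₁ : ℝ) + n₂) * Real.log (DH / ε))
        + 8646400 * (Dx ^ (5 / 2 : ℝ) * √L * X / ε ^ (5 / 2 : ℝ)) := by ring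
    _ ≤ 10 ^ 7 * (((n₁ : ℝ) + n₂) * Real.log (DH / ε))
        + 10 ^ 7 * (Dx ^ (5 / 2 : ℝ) * √L * X / ε ^ (5 / 2 : ℝ)) := by
      gcongr <;> norm_num
    _ = _ := by ring

end Nock

theorem theorem4 :
    ∃ (S : ℕ) (K : ℝ), ∀ (n₁ n₂ N₁ N₂ : ℕ) [NeZero n₁] [NeZero n₂] (P : COP n₁ n₂ N₁ N₂)
      (L LF BF LG BG : ℝ) (x₀ xopt : Vec N₂) (DH Dx ε : ℝ),
      P.IsConvex → P.IsSmooth LF BF LG BG → P.IsCompSmooth L →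
      (∀ x, P.H xopt ≤ P.H x) →
      0 < DH → 0 < Dx → 0 < ε →
      P.H x₀ - P.H xopt ≤ (DH : EReal) → ‖x₀ - xopt‖ ^ 2 ≤ Dx →
      DH / Dx ≤ L →
      let μ₀ : ℝ := DH / Dx
      let T : ℕ := ⌈Real.logb 2 (DH / ε)⌉₊
      (∀ (t : ℕ) (x : Vec N₂),
        expect (sock (P.regularize x₀ (μ₀ / 2 ^ t)) (sockParams L LF BF LG BG (μ₀ / 2 ^ t)) S x).law
            (P.regularize x₀ (μ₀ / 2 ^ t)).gap
          ≤ (P.regularize x₀ (μ₀ / 2 ^ t)).gap x / 4) ∧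
      P.IsStochasticSolution (nock P L LF BF LG BG S μ₀ T x₀).law ε ∧
      (2 * ε ≤ DH →
        ∀ r ∈ (nock P L LF BF LG BG S μ₀ T x₀).run.support,
          (r.2 : ℝ) ≤ K * ((n₁ + n₂) * Real.log (DH / ε)
            + Dx ^ (5 / 2 : ℝ) * √L * max (max (BG ^ 4 * LF ^ 2) (BF ^ 2 * LG ^ 2)) (L ^ 2)
              / ε ^ (5 / 2 : ℝ))) := by
  refine ⟨100, 10 ^ 7, ?_⟩
  intro n₁ n₂ N₁ N₂ _ _ P L LF BF LG BG x₀ xopt DH Dx ε hconv hs hc hmin hDH hDx hε hx₀ hxopt hL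
    μ₀ T
  have hP := hconv.isComposite hmin
  refine ⟨fun t x => ?_, ?_, fun hεDH r hr => ?_⟩
  · have hμ : 0 < DH / Dx / 2 ^ t := by positivity
    obtain ⟨v, hv⟩ := hP.exists_regularize hs x₀ hμ
    refine (hv.expect_sock_gap_le hμ ?_ (hs.regularize _ _) (hc.regularize _ _) x).trans ?_
    · exact (div_le_self (by positivity) (one_le_pow₀ one_le_two)).trans hL
    · exact ENNReal.div_le_div_left (by norm_num) _
  · refine (expect_nock_gap_le hP hs hc hDH hDx hx₀ hxopt hL T).trans
      (ENNReal.ofReal_le_ofReal ?_)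
    -- Also valid if `DH ≤ ε`: the natural ceiling is then `0`, and the output is `x₀`.
    have h1 : DH / ε ≤ 2 ^ T := by
      rw [← Real.rpow_natCast, ← Real.logb_le_iff_le_rpow one_lt_two (by positivity)]
      exact Nat.le_ceil _
    rw [div_le_iff₀ hε] at h1
    rw [div_le_iff₀ (by positivity)]
    linarith
  · exact cost_nock_le hDH hDx hε hL hεDH x₀ r hr
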